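/- For $n \ge 1$ let $a'(n)$ denote the number of conjugacy classes (under the conjugation action of $\mathrm{GL}_n(\mathbb{F}_2)$) consisting of squares $A^2$ with $A \in \mathrm{Mat}_n(\mathbb{F}_2)$, and let $b'(n)$ denote the number of conjugacy classes of $\mathrm{GL}_n(\mathbb{F}_2)$ consisting of squares $A^2$ with $A \in \mathrm{GL}_n(\mathbb{F}_2)$. Then, as formal power series in $z$, $$1 + \sum_{n=1}^{\infty} a'(n) z^n = \prod_{n=1}^{\infty}\frac{1-2z^{2n}}{(1-2z^n)(1-2z^{4n})}$$ and $$1 + \sum_{n=1}^{\infty} b'(n) z^n = \prod_{n=1}^{\infty}\frac{(1-z^{2n})(1-2z^{2n})}{(1+z^{2n-1})(1-2z^n)(1-2z^{4n})}.$$ Moreover, as $n \to \infty$, $a'(n) \sim \alpha' 2^n$ and $b'(n) \sim \beta' 2^n$, where $\alpha', \beta' > 0$ are the values of the convergent products $$\alpha' = \prod_{n=1}^{\infty}\frac{1-2\cdot 2^{-2n}}{(1-2^{-n})(1-2\cdot 2^{-4n})}, \qquad \beta' = \prod_{n=1}^{\infty}\frac{(1-2^{-2n})(1-2\cdot 2^{-2n})}{(1+2^{-(2n-1)})(1-2^{-n})(1-2\cdot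 2^{-4n})}.$$ -/

import Mathlib

open scoped PowerSeries.WithPiTopology Asymptotics

/-- The number of conjugacy classes of squares in a monoid `M`, where `a` and `b` are conjugate
if `u * a = b * u` for some unit `u` of `M`. For `M` the monoid of `n × n` matrices over a field
this relation is similarity of matrices. -/
noncomputable def numSquareClasses (M : Type*) [Monoid M] : ℕ :=
  Set.ncard {c : ConjClasses M | ∃ x : M, c = ConjClasses.mk (x ^ 2)}

/-- The number of conjugacy classes of squares in `Mat_n(𝔽₂)`. -/
noncomputable def squareClassesMat (n : ℕ) : ℕ :=
  numSquareClasses (Matrix (Fin n) (Fin n) (ZMod 2))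

/-- The number of conjugacy classes of squares in `GL_n(𝔽₂)`. -/
noncomputable def squareClassesGL (n : ℕ) : ℕ :=
  numSquareClasses (Matrix.GeneralLinearGroup (Fin n) (ZMod 2))

/-- The formal power series `1 + ∑_{n ≥ 1} c(n) z ^ n`. -/
noncomputable def genFun (c : ℕ → ℕ) : PowerSeries ℤ :=
  1 + PowerSeries.mk (fun n => if n = 0 then 0 else (c n : ℤ))

/-- The formal quotient `f / g` of integral power series, where `g` has constant term `1`. -/
noncomputable def seriesDiv (f g : PowerSeries ℤ) : PowerSeries ℤ :=
  f * PowerSeries.invOfUnit g 1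

/-- `seriesDiv` really is division by a series with constant term `1`. -/
theorem seriesDiv_mul_cancel (f g : PowerSeries ℤ) (hg : PowerSeries.constantCoeff g = 1) :
    seriesDiv f g * g = f := by
  rw [seriesDiv, mul_assoc, mul_comm (PowerSeries.invOfUnit g 1) g,
    PowerSeries.mul_invOfUnit g 1 (by simpa using hg), mul_one]

/-! A matrix `A` over `ZMod 2` makes the column space a finite `(ZMod 2)[X]`-module, and similarity
is isomorphism of such modules. A finite module is determined by the sizes of its `φ ^ k`-torsion,
`φ` monic irreducible (`nonempty_equiv_of_torsionCard_eq`). By Frobenius `p(X ^ 2) = p(X) ^ 2`, so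
the `φ ^ k`-torsion for `A ^ 2` is the `φ ^ (2 * k)`-torsion for `A`
(`torsionCard_matrixModule_sq`).

Let `ν l` be the number of `φ`-primary blocks of `A` of exponent greater than `l`. For `A ^ 2` this
sequence becomes `ν (2 * l) + ν (2 * l + 1)`. As `ν` decreases, the new sequence takes each odd
value at most once, and this is the only constraint. Let `g j` be the quotient of the `j`-th
invariant factor of `A ^ 2` by the next one, starting from `j = 0` at the largest. The multiplicity
of `φ` in `g j` counts how often the value `j + 1` occurs. Hence classes of squares correspond to
sequences of monic `g j`, squarefree for even `j`, with `∑ (j + 1) * deg (g j) = n`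
(`ncard_squareClasses`); invertibility adds `¬ X ∣ g j`.

The generating function is therefore a product over `k = j + 1`: squarefree polynomials for odd `k`,
all monic ones for even `k`. Monic polynomials give `1 / (1 - 2 z ^ k)`. Writing `f = s * t ^ 2`
gives `(1 - 2 z ^ (2 k)) / (1 - 2 z ^ k)` for squarefree ones, and splitting off powers of `X`
handles the invertible case. Regrouping by parity yields the stated products.

Only the factor `k = 1` has a pole at `z = 1 / 2`. After multiplication by `1 - 2 z` the series
converges there, and its partial sums are `c n / 2 ^ n` for large `n`, so its value is the
asymptotic constant. -/

section PolynomialModules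

open Polynomial

/-! ### Torsion counts in cyclic modules over `(ZMod 2)[X]`. -/

/-- The number of elements of `M` annihilated by the polynomial `a`. -/
noncomputable def torsionCard (M : Type*) [AddCommGroup M] [Module (ZMod 2)[X] M]
    (a : (ZMod 2)[X]) : ℕ :=
  Nat.card (Submodule.torsionBy (ZMod 2)[X] M a)

theorem torsionCard_congr {M N : Type*} [AddCommGroup M] [Module (ZMod 2)[X] M]
    [AddCommGroup N] [Module (ZMod 2)[X] N] (e : M ≃ₗ[(ZMod 2)[X]] N) (a : (ZMod 2)[X]) :
    torsionCard M a = torsionCard N a := by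
  refine Nat.card_congr (e.toEquiv.subtypeEquiv fun x => ?_)
  simp only [Submodule.mem_torsionBy_iff, LinearEquiv.coe_toEquiv]
  rw [← map_smul, LinearEquiv.map_eq_zero_iff]

theorem torsionCard_pi {ι : Type*} [Fintype ι] (M : ι → Type*) [∀ i, AddCommGroup (M i)]
    [∀ i, Module (ZMod 2)[X] (M i)] (a : (ZMod 2)[X]) :
    torsionCard (∀ i, M i) a = ∏ i, torsionCard (M i) a := by
  unfold torsionCard
  rw [← Nat.card_pi]
  refine Nat.card_congr ((Equiv.subtypeEquivRight fun x => ?_).trans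
    (Equiv.subtypePiEquivPi (p := fun i x => x ∈ Submodule.torsionBy (ZMod 2)[X] (M i) a)))
  simp only [Submodule.mem_torsionBy_iff, funext_iff, Pi.smul_apply, Pi.zero_apply]

theorem finite_quotient_span {f : (ZMod 2)[X]} (hf : f ≠ 0) :
    Finite ((ZMod 2)[X] ⧸ Ideal.span {f}) := by
  have : Module.Finite (ZMod 2) ((ZMod 2)[X] ⧸ Ideal.span {f}) :=
    (AdjoinRoot.powerBasis hf).finite
  exact Module.finite_of_finite (ZMod 2)

theorem card_quotient_span {f : (ZMod 2)[X]} (hf : f ≠ 0) :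
    Nat.card ((ZMod 2)[X] ⧸ Ideal.span {f}) = 2 ^ f.natDegree := by
  have : Module.Finite (ZMod 2) ((ZMod 2)[X] ⧸ Ideal.span {f}) :=
    (AdjoinRoot.powerBasis hf).finite
  rw [Module.natCard_eq_pow_finrank (K := ZMod 2), finrank_quotient_span_eq_natDegree]
  simp

/-- For an endomorphism of a finite group, kernel and cokernel have the same size. The cokernel of
`a` on a cyclic module is again cyclic, which makes it easy to count. -/
theorem torsionCard_eq_card_quotient_range (M : Type*) [AddCommGroup M] [Module (ZMod 2)[X] M]
    [Finite M] (a : (ZMod 2)[X]) :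
    torsionCard M a = Nat.card (M ⧸ LinearMap.range (LinearMap.lsmul (ZMod 2)[X] M a)) := by
  have h1 := Submodule.card_eq_card_quotient_mul_card
    (LinearMap.ker (LinearMap.lsmul (ZMod 2)[X] M a))
  have h2 := Submodule.card_eq_card_quotient_mul_card
    (LinearMap.range (LinearMap.lsmul (ZMod 2)[X] M a))
  rw [Nat.card_congr (LinearMap.quotKerEquivRange _).toEquiv] at h1
  have h3 : 0 < Nat.card (LinearMap.range (LinearMap.lsmul (ZMod 2)[X] M a)) := Nat.card_pos
  have h4 : torsionCard M a = Nat.card (LinearMap.ker (LinearMap.lsmul (ZMod 2)[X] M a)) := rfl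
  rw [h4]
  apply Nat.eq_of_mul_eq_mul_left h3
  linarith

theorem torsionCard_quotient (f a g : (ZMod 2)[X]) (hf : f ≠ 0)
    (hg : Ideal.span {f} ⊔ Ideal.span {a} = Ideal.span {g}) :
    torsionCard ((ZMod 2)[X] ⧸ Ideal.span {f}) a = 2 ^ g.natDegree := by
  have := finite_quotient_span hf
  have hg0 : g ≠ 0 := by
    rintro rfl
    have : f ∈ Ideal.span {f} ⊔ Ideal.span {a} :=
      Ideal.mem_sup_left (Ideal.mem_span_singleton_self f)
    rw [hg] at this
    simp at this
    exact hf this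
  rw [torsionCard_eq_card_quotient_range, ← card_quotient_span hg0, ← hg,
    ← Nat.card_congr (DoubleQuot.quotQuotEquivQuotSup (Ideal.span {f}) (Ideal.span {a})).toEquiv]
  have : (LinearMap.range (LinearMap.lsmul (ZMod 2)[X] ((ZMod 2)[X] ⧸ Ideal.span {f}) a)) =
      (Ideal.map (Ideal.Quotient.mk (Ideal.span {f})) (Ideal.span {a})).restrictScalars
        (ZMod 2)[X] := by
    ext x
    rw [Ideal.map_span, Set.image_singleton]
    simp only [LinearMap.mem_range, LinearMap.lsmul_apply, Submodule.restrictScalars_mem,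
      Ideal.mem_span_singleton']
    constructor
    · rintro ⟨y, rfl⟩
      exact ⟨y, by rw [mul_comm]; rfl⟩
    · rintro ⟨y, rfl⟩
      exact ⟨y, by rw [mul_comm]; rfl⟩
  rw [this]
  exact Nat.card_congr (Submodule.Quotient.restrictScalarsEquiv (ZMod 2)[X] _).toEquiv

theorem span_sup_span_pow {φ f : (ZMod 2)[X]} (hφ : Irreducible φ) (hf : f ≠ 0) (k : ℕ) :
    Ideal.span {f} ⊔ Ideal.span {φ ^ k} = Ideal.span {φ ^ min k (multiplicity φ f)} := by
  have hfin : FiniteMultiplicity φ f := FiniteMultiplicity.of_not_isUnit hφ.not_isUnit hf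
  obtain ⟨c, hc, hc'⟩ := hfin.exists_eq_pow_mul_and_not_dvd
  have hcop : IsCoprime c φ := ((hφ.coprime_iff_not_dvd).2 hc').symm
  apply le_antisymm
  · rw [sup_le_iff, Ideal.span_singleton_le_span_singleton, Ideal.span_singleton_le_span_singleton]
    exact ⟨(pow_dvd_pow _ (min_le_right _ _)).trans (pow_multiplicity_dvd _ _),
      pow_dvd_pow _ (min_le_left _ _)⟩
  · rw [Ideal.span_singleton_le_iff_mem]
    obtain ⟨u, w, huw⟩ := hcop.pow_right (n := k)
    rcases le_total k (multiplicity φ f) with h | h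
    · rw [min_eq_left h]
      exact Ideal.mem_sup_right (Ideal.mem_span_singleton_self _)
    · rw [min_eq_right h, ← mul_one (φ ^ multiplicity φ f), ← huw, mul_add]
      refine Ideal.add_mem _ (Ideal.mem_sup_left ?_) (Ideal.mem_sup_right ?_)
      · rw [Ideal.mem_span_singleton]
        exact ⟨u, by conv_rhs => rw [hc]
                     ring⟩
      · rw [Ideal.mem_span_singleton]
        exact ⟨φ ^ multiplicity φ f * w, by ring⟩

theorem torsionCard_quotient_pow {φ f : (ZMod 2)[X]} (hφ : Irreducible φ) (hf : f ≠ 0) (k : ℕ) :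
    torsionCard ((ZMod 2)[X] ⧸ Ideal.span {f}) (φ ^ k) =
      2 ^ (φ.natDegree * min k (multiplicity φ f)) := by
  rw [torsionCard_quotient _ _ _ hf (span_sup_span_pow hφ hf k), natDegree_pow, mul_comm]

theorem torsionCard_pi_quotient {ι : Type*} [Fintype ι] {φ : (ZMod 2)[X]} (hφ : Irreducible φ)
    (f : ι → (ZMod 2)[X]) (hf : ∀ i, f i ≠ 0) (k : ℕ) :
    torsionCard (∀ i, (ZMod 2)[X] ⧸ Ideal.span {f i}) (φ ^ k) =
      2 ^ (φ.natDegree * ∑ i, min k (multiplicity φ (f i))) := by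
  rw [torsionCard_pi, Finset.mul_sum, ← Finset.prod_pow_eq_pow_sum]
  exact Finset.prod_congr rfl fun i _ => torsionCard_quotient_pow hφ (hf i) k

theorem card_pi_quotient {ι : Type*} [Fintype ι] (f : ι → (ZMod 2)[X]) (hf : ∀ i, f i ≠ 0) :
    Nat.card (∀ i, (ZMod 2)[X] ⧸ Ideal.span {f i}) = 2 ^ (∑ i, (f i).natDegree) := by
  rw [Nat.card_pi, ← Finset.prod_pow_eq_pow_sum]
  exact Finset.prod_congr rfl fun i _ => card_quotient_span (hf i)

theorem multiplicity_prime_pow {φ p : (ZMod 2)[X]} (hφ : Irreducible φ) (hφm : φ.Monic)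
    (hp : Irreducible p) (e : ℕ) :
    multiplicity φ (p ^ e) = if normalize p = φ then e else 0 := by
  split_ifs with h
  · have : Associated p φ := h ▸ (normalize_associated p).symm
    rw [multiplicity_eq_of_associated_right (this.pow_pow (n := e))]
    exact multiplicity_pow_self_of_prime hφ.prime e
  · apply multiplicity_eq_zero.2
    intro hd
    apply h
    have := (hφ.dvd_irreducible_iff_associated hp).1 (hφ.prime.dvd_of_dvd_pow hd)
    rw [← hφm.normalize_eq_self]
    exact normalize_eq_normalize_iff_associated.2 this.symm

/-! ### Classification of finite modules by their torsion counts. -/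

theorem isTorsion_of_finite_polynomial_module (M : Type*) [AddCommGroup M]
    [Module (ZMod 2)[X] M] [Finite M] :
    Module.IsTorsion (ZMod 2)[X] M := by
  intro x
  have : ¬ Function.Injective fun r : (ZMod 2)[X] => r • x := not_injective_infinite_finite _
  simp only [Function.Injective, not_forall] at this
  obtain ⟨a, b, hab, hne⟩ := this
  refine ⟨⟨a - b, mem_nonZeroDivisors_of_ne_zero (sub_ne_zero.2 hne)⟩, ?_⟩
  change (a - b) • x = 0
  rw [sub_smul, sub_eq_zero]
  exact hab

/-- The structure theorem with trivial blocks discarded: exponent `0` is invisible to torsion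
counts, so such blocks would spoil the matching of index sets. -/
theorem exists_equiv_pi_quotient (M : Type*) [AddCommGroup M] [Module (ZMod 2)[X] M] [Finite M] :
    ∃ (ι : Type) (_ : Fintype ι) (p : ι → (ZMod 2)[X]) (e : ι → ℕ), (∀ i, Irreducible (p i)) ∧
      (∀ i, e i ≠ 0) ∧
      Nonempty (M ≃ₗ[(ZMod 2)[X]] ∀ i, (ZMod 2)[X] ⧸ Ideal.span {p i ^ e i}) := by
  classical
  have : Module.Finite (ZMod 2)[X] M := Module.Finite.of_finite
  obtain ⟨ι, _, p, hp, e, ⟨E⟩⟩ :=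
    Module.equiv_directSum_of_isTorsion (isTorsion_of_finite_polynomial_module M)
  refine ⟨{i : ι // e i ≠ 0}, inferInstance, fun i => p i, fun i => e i, fun i => hp i,
    fun i => i.2, ⟨E.trans ((DirectSum.linearEquivFunOnFintype _ _ _).trans
      (LinearEquiv.ofBijective (LinearMap.pi fun i => LinearMap.proj i.1) ⟨?_, ?_⟩))⟩⟩
  · intro x y hxy
    funext i
    by_cases hi : e i = 0
    · have : Subsingleton ((ZMod 2)[X] ⧸ Ideal.span {p i ^ e i}) := by
        rw [hi, pow_zero, Ideal.span_singleton_one]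
        infer_instance
      exact Subsingleton.elim (α := (ZMod 2)[X] ⧸ Ideal.span {p i ^ e i}) _ _
    · exact congrFun hxy ⟨i, hi⟩
  · intro y
    refine ⟨fun i => if hi : e i ≠ 0 then y ⟨i, hi⟩ else 0, ?_⟩
    funext i
    simp [i.2]

theorem sum_min_eq_sum_card {ι : Type*} (s : Finset ι) (m : ι → ℕ) (k : ℕ) :
    ∑ i ∈ s, min k (m i) = ∑ l ∈ Finset.range k, (s.filter fun i => l < m i).card := by
  have h (a : ℕ) : min k a = ∑ l ∈ Finset.range k, if l < a then 1 else 0 := by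
    rw [← Finset.card_filter]
    have : (Finset.range k).filter (· < a) = Finset.range (min k a) := by
      ext; simp
    rw [this, Finset.card_range]
  simp_rw [h, Finset.card_filter]
  exact Finset.sum_comm

theorem eq_of_sum_range_eq {u v : ℕ → ℕ}
    (h : ∀ k, ∑ l ∈ Finset.range k, u l = ∑ l ∈ Finset.range k, v l) (k : ℕ) : u k = v k := by
  have := h (k + 1)
  rw [Finset.sum_range_succ, Finset.sum_range_succ, h k] at this
  omega

/-- The number of blocks `R ⧸ (φ ^ l)` with `l > k` in a direct sum of the `R ⧸ (p i ^ e i)`. -/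
noncomputable def blockCount {ι : Type*} [Fintype ι] (p : ι → (ZMod 2)[X]) (e : ι → ℕ)
    (φ : (ZMod 2)[X]) (k : ℕ) : ℕ :=
  (Finset.univ.filter fun i => k < multiplicity φ (p i ^ e i)).card

theorem torsionCard_eq_blockCount {ι : Type*} [Fintype ι] {p : ι → (ZMod 2)[X]}
    (hp : ∀ i, Irreducible (p i)) (e : ι → ℕ) {M : Type*} [AddCommGroup M]
    [Module (ZMod 2)[X] M] (E : M ≃ₗ[(ZMod 2)[X]] ∀ i, (ZMod 2)[X] ⧸ Ideal.span {p i ^ e i})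
    {φ : (ZMod 2)[X]} (hφ : Irreducible φ) (k : ℕ) :
    torsionCard M (φ ^ k) =
      2 ^ (φ.natDegree * ∑ l ∈ Finset.range k, blockCount p e φ l) := by
  rw [torsionCard_congr E, torsionCard_pi_quotient hφ _ fun i => pow_ne_zero _ (hp i).ne_zero,
    sum_min_eq_sum_card]
  rfl

theorem blockCount_eq_add {ι : Type*} [Fintype ι] [DecidableEq (ZMod 2)[X]]
    {p : ι → (ZMod 2)[X]} (hp : ∀ i, Irreducible (p i)) (e : ι → ℕ) {φ : (ZMod 2)[X]}
    (hφ : Irreducible φ) (hφm : φ.Monic) (k : ℕ) :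
    blockCount p e φ k = blockCount p e φ (k + 1) +
      Fintype.card {i // (normalize (p i), e i) = (φ, k + 1)} := by
  classical
  rw [Fintype.card_subtype, blockCount, blockCount, ← Finset.card_union_of_disjoint]
  · congr 1
    ext i
    simp only [multiplicity_prime_pow hφ hφm (hp i), Finset.mem_filter, Finset.mem_univ, true_and,
      Finset.mem_union, Prod.mk.injEq]
    split_ifs with h <;> simp [h]
    omega
  · rw [Finset.disjoint_filter]
    rintro i - h1 h2
    rw [Prod.mk.injEq] at h2
    rw [multiplicity_prime_pow hφ hφm (hp i), if_pos h2.1, h2.2] at h1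
    exact lt_irrefl _ h1

theorem exponent_eq_of_torsionCard {φ : (ZMod 2)[X]} (hφ : Irreducible φ) {u v : ℕ}
    (h : 2 ^ (φ.natDegree * u) = 2 ^ (φ.natDegree * v)) : u = v :=
  Nat.eq_of_mul_eq_mul_left hφ.natDegree_pos (Nat.pow_right_injective le_rfl h)

/-- The logarithm of the `φ ^ k`-torsion is a partial sum of block counts. Differences in `k`
recover the block counts, and a further difference gives the number of blocks of each exact
exponent. -/
theorem nonempty_equiv_of_torsionCard_eq (M N : Type*) [AddCommGroup M] [Module (ZMod 2)[X] M]
    [Finite M] [AddCommGroup N] [Module (ZMod 2)[X] N] [Finite N]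
    (h : ∀ φ : (ZMod 2)[X], Irreducible φ → φ.Monic → ∀ k,
      torsionCard M (φ ^ k) = torsionCard N (φ ^ k)) :
    Nonempty (M ≃ₗ[(ZMod 2)[X]] N) := by
  classical
  obtain ⟨ι, _, p, e, hp, he, ⟨E⟩⟩ := exists_equiv_pi_quotient M
  obtain ⟨κ, _, q, d, hq, hd, ⟨D⟩⟩ := exists_equiv_pi_quotient N
  have hb (φ : (ZMod 2)[X]) (hφ : Irreducible φ) (hφm : φ.Monic) (k : ℕ) :
      blockCount p e φ k = blockCount q d φ k := by
    refine eq_of_sum_range_eq (fun k => exponent_eq_of_torsionCard hφ ?_) k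
    rw [← torsionCard_eq_blockCount hp e E hφ, ← torsionCard_eq_blockCount hq d D hφ, h φ hφ hφm]
  have hc (c : (ZMod 2)[X] × ℕ) : Fintype.card {i // (normalize (p i), e i) = c} =
      Fintype.card {i // (normalize (q i), d i) = c} := by
    obtain ⟨φ, k⟩ := c
    by_cases hφ : Irreducible φ ∧ φ.Monic
    · cases k with
      | zero =>
        have h1 : IsEmpty {i // (normalize (p i), e i) = (φ, 0)} :=
          ⟨fun i => he i.1 (Prod.mk.inj i.2).2⟩
        have h2 : IsEmpty {i // (normalize (q i), d i) = (φ, 0)} :=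
          ⟨fun i => hd i.1 (Prod.mk.inj i.2).2⟩
        rw [Fintype.card_eq_zero, Fintype.card_eq_zero]
      | succ k =>
        have h1 := blockCount_eq_add hp e hφ.1 hφ.2 k
        have h2 := blockCount_eq_add hq d hφ.1 hφ.2 k
        rw [hb φ hφ.1 hφ.2, hb φ hφ.1 hφ.2] at h1
        omega
    · have key {r : (ZMod 2)[X]} (hr : Irreducible r) : normalize r ≠ φ := by
        rintro rfl
        exact hφ ⟨(normalize_associated r).symm.irreducible hr, monic_normalize hr.ne_zero⟩
      have h1 : IsEmpty {i // (normalize (p i), e i) = (φ, k)} :=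
        ⟨fun i => key (hp _) (Prod.mk.inj i.2).1⟩
      have h2 : IsEmpty {i // (normalize (q i), d i) = (φ, k)} :=
        ⟨fun i => key (hq _) (Prod.mk.inj i.2).1⟩
      rw [Fintype.card_eq_zero, Fintype.card_eq_zero]
  -- Equal fibres over every pair (normalized prime, exponent) glue to a bijection of the blocks.
  let σ : ι ≃ κ := Equiv.ofFiberEquiv (f := fun i => (normalize (p i), e i))
    (g := fun i => (normalize (q i), d i)) fun c => Fintype.equivOfCardEq (hc c)
  have hσ (i : ι) : (normalize (q (σ i)), d (σ i)) = (normalize (p i), e i) :=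
    Equiv.ofFiberEquiv_map (f := fun i => (normalize (p i), e i))
      (g := fun i => (normalize (q i), d i)) _ i
  have hspan (i : ι) : Ideal.span {p i ^ e i} = Ideal.span {q (σ i) ^ d (σ i)} := by
    obtain ⟨h1, h2⟩ := Prod.mk.inj (hσ i)
    rw [h2]
    exact Ideal.span_singleton_eq_span_singleton.2
      ((normalize_eq_normalize_iff_associated.1 h1).symm.pow_pow)
  exact ⟨E.trans ((LinearEquiv.piCongrRight fun i => Submodule.quotEquivOfEq _ _ (hspan i)).trans
    ((LinearEquiv.piCongrLeft (ZMod 2)[X]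
      (fun i => (ZMod 2)[X] ⧸ Ideal.span {q i ^ d i}) σ).trans D.symm))⟩

/-! ### Divisibility and squarefreeness read off from multiplicities. -/

theorem finiteMultiplicity_of_irreducible {φ f : (ZMod 2)[X]} (hφ : Irreducible φ) (hf : f ≠ 0) :
    FiniteMultiplicity φ f :=
  FiniteMultiplicity.of_not_isUnit hφ.not_isUnit hf

theorem multiplicity_mul_of_ne_zero {φ f g : (ZMod 2)[X]} (hφ : Irreducible φ) (hf : f ≠ 0)
    (hg : g ≠ 0) : multiplicity φ (f * g) = multiplicity φ f + multiplicity φ g :=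
  multiplicity_mul hφ.prime (finiteMultiplicity_of_irreducible hφ (mul_ne_zero hf hg))

theorem multiplicity_one_of_irreducible {φ : (ZMod 2)[X]} (hφ : Irreducible φ) :
    multiplicity φ (1 : (ZMod 2)[X]) = 0 :=
  multiplicity_eq_zero.2 fun h => hφ.not_isUnit (isUnit_of_dvd_one h)

theorem multiplicity_prod_of_ne_zero {ι : Type*} {φ : (ZMod 2)[X]} (hφ : Irreducible φ)
    (s : Finset ι) (f : ι → (ZMod 2)[X]) (hf : ∀ i ∈ s, f i ≠ 0) :
    multiplicity φ (∏ i ∈ s, f i) = ∑ i ∈ s, multiplicity φ (f i) := by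
  classical
  induction s using Finset.induction with
  | empty => simpa using multiplicity_one_of_irreducible hφ
  | insert a s ha ih =>
    rw [Finset.prod_insert ha, Finset.sum_insert ha, multiplicity_mul_of_ne_zero hφ
      (hf a (Finset.mem_insert_self _ _))
      (Finset.prod_ne_zero_iff.2 fun i hi => hf i (Finset.mem_insert_of_mem hi)),
      ih fun i hi => hf i (Finset.mem_insert_of_mem hi)]

theorem dvd_of_multiplicity_le {f g : (ZMod 2)[X]} (hf : f ≠ 0) (hg : g ≠ 0)
    (h : ∀ φ : (ZMod 2)[X], Irreducible φ → φ.Monic → multiplicity φ f ≤ multiplicity φ g) :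
    f ∣ g := by
  classical
  rw [UniqueFactorizationMonoid.dvd_iff_emultiplicity_le hf]
  intro p hp
  have hass := normalize_associated p
  rw [emultiplicity_eq_of_associated_left hass, emultiplicity_eq_of_associated_left hass]
  have hirr : Irreducible (normalize p) := hass.symm.irreducible hp.irreducible
  rw [(finiteMultiplicity_of_irreducible hirr hf).emultiplicity_eq_multiplicity,
    (finiteMultiplicity_of_irreducible hirr hg).emultiplicity_eq_multiplicity]
  exact_mod_cast h _ hirr (monic_normalize hp.ne_zero)

theorem eq_of_multiplicity_eq {f g : (ZMod 2)[X]} (hf : f.Monic) (hg : g.Monic)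
    (h : ∀ φ : (ZMod 2)[X], Irreducible φ → φ.Monic → multiplicity φ f = multiplicity φ g) :
    f = g :=
  eq_of_monic_of_associated hf hg (associated_of_dvd_dvd
    (dvd_of_multiplicity_le hf.ne_zero hg.ne_zero fun φ h1 h2 => (h φ h1 h2).le)
    (dvd_of_multiplicity_le hg.ne_zero hf.ne_zero fun φ h1 h2 => (h φ h1 h2).ge))

theorem multiplicity_le_one_of_squarefree {φ f : (ZMod 2)[X]} (hφ : Irreducible φ)
    (hf : Squarefree f) : multiplicity φ f ≤ 1 := by
  by_contra! h
  exact hφ.not_isUnit (hf φ (by rw [← sq]; exact pow_dvd_of_le_multiplicity h))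

theorem squarefree_of_multiplicity_le_one {f : (ZMod 2)[X]} (hf : f ≠ 0)
    (h : ∀ φ : (ZMod 2)[X], Irreducible φ → φ.Monic → multiplicity φ f ≤ 1) : Squarefree f := by
  classical
  rw [squarefree_iff_no_irreducibles hf]
  intro p hp hd
  have hass := normalize_associated p
  have hirr : Irreducible (normalize p) := hass.symm.irreducible hp
  have h2 : normalize p ^ 2 ∣ f := by
    rw [sq]
    exact ((hass.mul_mul hass).dvd).trans hd
  have := (finiteMultiplicity_of_irreducible hirr hf).le_multiplicity_of_pow_dvd h2
  have := h _ hirr (monic_normalize hp.ne_zero)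
  omega

/-! ### Invariant factors, their successive quotients, and transposition of partitions. -/

/-- A downward closed bounded set of naturals is an initial segment, so its size determines it. This
is what makes transposing a partition an involution. -/
theorem lt_card_filter_range_iff {p : ℕ → Prop} [DecidablePred p] (hp : ∀ a b, a ≤ b → p b → p a)
    {E : ℕ} (hE : ∀ l, E ≤ l → ¬ p l) (l : ℕ) :
    l < ((Finset.range E).filter p).card ↔ p l := by
  constructor
  · intro h
    by_contra hl
    have : (Finset.range E).filter p ⊆ Finset.range l := by
      intro x hx
      rw [Finset.mem_filter] at hx
      rw [Finset.mem_range]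
      by_contra! hlx
      exact hl (hp _ _ hlx hx.2)
    have := Finset.card_le_card this
    rw [Finset.card_range] at this
    omega
  · intro h
    have : Finset.range (l + 1) ⊆ (Finset.range E).filter p := by
      intro x hx
      rw [Finset.mem_range] at hx
      rw [Finset.mem_filter, Finset.mem_range]
      have hpx : p x := hp _ _ (by omega) h
      refine ⟨?_, hpx⟩
      by_contra! hx'
      exact hE _ hx' hpx
    have := Finset.card_le_card this
    rw [Finset.card_range] at this
    omega

/-- The product `g i * g (i + 1) * ⋯ * g (N - 1)`. -/
noncomputable def tailProd (g : ℕ → (ZMod 2)[X]) (N i : ℕ) : (ZMod 2)[X] :=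
  ∏ j ∈ Finset.Ico i N, g j

/-- The module with invariant factors `tailProd g N i`, `i < N`. -/
abbrev TailModule (g : ℕ → (ZMod 2)[X]) (N : ℕ) : Type :=
  ∀ i : Fin N, (ZMod 2)[X] ⧸ Ideal.span {tailProd g N i}

section tailProd

variable {g g' : ℕ → (ZMod 2)[X]} {N : ℕ}

theorem monic_tailProd (hg : ∀ j, (g j).Monic) (N i : ℕ) : (tailProd g N i).Monic :=
  monic_prod_of_monic _ _ fun j _ => hg j

theorem tailProd_eq_one {i : ℕ} (h : N ≤ i) : tailProd g N i = 1 := by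
  rw [tailProd, Finset.Ico_eq_empty_of_le h, Finset.prod_empty]

theorem tailProd_eq_mul (h1 : ∀ j, N ≤ j → g j = 1) (i : ℕ) :
    tailProd g N i = g i * tailProd g N (i + 1) := by
  rcases lt_or_ge i N with h | h
  · exact Finset.prod_eq_prod_Ico_succ_bot h _
  · rw [tailProd_eq_one h, tailProd_eq_one (by omega), h1 i h, one_mul]

/-- The factor `g j` occurs in exactly the `j + 1` tails with index `0, …, j`. -/
theorem sum_natDegree_tailProd (hg : ∀ j, (g j).Monic) :
    ∑ i ∈ Finset.range N, (tailProd g N i).natDegree =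
      ∑ j ∈ Finset.range N, (j + 1) * (g j).natDegree := by
  simp_rw [tailProd, natDegree_prod_of_monic _ _ fun j _ => hg j]
  rw [Finset.range_eq_Ico, Finset.sum_Ico_Ico_comm]
  refine Finset.sum_congr rfl fun j _ => ?_
  simp

theorem finite_tailModule (hg : ∀ j, (g j).Monic) : Finite (TailModule g N) := by
  have (i : Fin N) := finite_quotient_span (monic_tailProd hg N i).ne_zero
  infer_instance

theorem card_tailModule (hg : ∀ j, (g j).Monic) :
    Nat.card (TailModule g N) = 2 ^ ∑ j ∈ Finset.range N, (j + 1) * (g j).natDegree := by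
  rw [card_pi_quotient (fun i : Fin N => tailProd g N i) fun i => (monic_tailProd hg N i).ne_zero,
    ← sum_natDegree_tailProd hg,
    Finset.sum_range]

theorem torsionCard_tailModule (hg : ∀ j, (g j).Monic) {φ : (ZMod 2)[X]} (hφ : Irreducible φ)
    (k : ℕ) : torsionCard (TailModule g N) (φ ^ k) =
      2 ^ (φ.natDegree * ∑ i ∈ Finset.range N, min k (multiplicity φ (tailProd g N i))) := by
  rw [torsionCard_pi_quotient hφ (fun i : Fin N => tailProd g N i) fun i =>
    (monic_tailProd hg N i).ne_zero, Finset.sum_range]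

theorem multiplicity_tailProd_antitone (hg : ∀ j, (g j).Monic) (h1 : ∀ j, N ≤ j → g j = 1)
    {φ : (ZMod 2)[X]} (hφ : Irreducible φ) :
    Antitone fun i => multiplicity φ (tailProd g N i) := by
  refine antitone_nat_of_succ_le fun i => ?_
  rw [tailProd_eq_mul h1 i, multiplicity_mul_of_ne_zero hφ (hg i).ne_zero
    (monic_tailProd hg N _).ne_zero]
  exact Nat.le_add_left _ _

/-- Uniqueness of invariant factors. Torsion counts give the number of tails in which `φ` has
multiplicity above `k`; multiplicities decrease along the tails, so this number tells which tails
they are. -/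
theorem eq_of_tailModule_equiv (hg : ∀ j, (g j).Monic) (h1 : ∀ j, N ≤ j → g j = 1)
    (hg' : ∀ j, (g' j).Monic) (h1' : ∀ j, N ≤ j → g' j = 1)
    (e : TailModule g N ≃ₗ[(ZMod 2)[X]] TailModule g' N) : g = g' := by
  have key (i : ℕ) : tailProd g N i = tailProd g' N i := by
    refine eq_of_multiplicity_eq (monic_tailProd hg N i) (monic_tailProd hg' N i) fun φ hφ hφm => ?_
    have hsum (k : ℕ) : ∑ i ∈ Finset.range N, min k (multiplicity φ (tailProd g N i)) =
        ∑ i ∈ Finset.range N, min k (multiplicity φ (tailProd g' N i)) := by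
      apply exponent_eq_of_torsionCard hφ
      rw [← torsionCard_tailModule hg hφ, ← torsionCard_tailModule hg' hφ, torsionCard_congr e]
    simp_rw [sum_min_eq_sum_card] at hsum
    have hcard := eq_of_sum_range_eq hsum
    have hlt {f : ℕ → (ZMod 2)[X]} (hf : ∀ j, (f j).Monic) (hf1 : ∀ j, N ≤ j → f j = 1) (k : ℕ) :
        i < ((Finset.range N).filter fun i => k < multiplicity φ (tailProd f N i)).card ↔
          k < multiplicity φ (tailProd f N i) := by
      refine lt_card_filter_range_iff (p := fun i => k < multiplicity φ (tailProd f N i))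
        (fun a b hab hb => hb.trans_le (multiplicity_tailProd_antitone hf hf1 hφ hab)) ?_ i
      intro l hl
      rw [tailProd_eq_one hl, multiplicity_one_of_irreducible hφ]
      exact Nat.not_lt_zero _
    have hiff (k : ℕ) :
        k < multiplicity φ (tailProd g N i) ↔ k < multiplicity φ (tailProd g' N i) := by
      rw [← hlt hg h1 k, ← hlt hg' h1' k, hcard k]
    exact le_antisymm (le_of_not_gt fun h => lt_irrefl _ ((hiff _).1 h))
      (le_of_not_gt fun h => lt_irrefl _ ((hiff _).2 h))
  funext j
  have h2 := key j
  rw [tailProd_eq_mul h1, tailProd_eq_mul h1', key (j + 1)] at h2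
  exact mul_right_cancel₀ (monic_tailProd hg' N _).ne_zero h2

/-- Realizes prescribed block counts `ν φ` by invariant factors. The witness `g j` contains `φ` once
for each `k` with `ν φ k = j + 1`; its tails then carry the transposed partition, and transposing
again returns `ν φ`. The bound `E` only keeps these counts finite. -/
theorem exists_tail_of_antitone (S : Finset (ZMod 2)[X])
    (hS : ∀ φ ∈ S, Irreducible φ ∧ φ.Monic) (ν : (ZMod 2)[X] → ℕ → ℕ)
    (hanti : ∀ φ, Irreducible φ → φ.Monic → Antitone (ν φ))
    (hle : ∀ φ, Irreducible φ → φ.Monic → ν φ 0 ≤ N)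
    (hzero : ∀ φ, Irreducible φ → φ.Monic → φ ∉ S → ∀ k, ν φ k = 0)
    (E : ℕ) (hE : ∀ φ, Irreducible φ → φ.Monic → ∀ k, E ≤ k → ν φ k = 0) :
    ∃ g : ℕ → (ZMod 2)[X], (∀ j, (g j).Monic) ∧ (∀ j, N ≤ j → g j = 1) ∧
      (∀ φ, Irreducible φ → φ.Monic → ∀ j,
        multiplicity φ (g j) = ((Finset.range E).filter fun k => ν φ k = j + 1).card) ∧
      ∀ φ, Irreducible φ → φ.Monic → ∀ k,
        ∑ i ∈ Finset.range N, min k (multiplicity φ (tailProd g N i)) =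
          ∑ l ∈ Finset.range k, ν φ l := by
  classical
  let g : ℕ → (ZMod 2)[X] := fun j =>
    ∏ φ ∈ S, φ ^ ((Finset.range E).filter fun k => ν φ k = j + 1).card
  have hmon (j : ℕ) : (g j).Monic := monic_prod_of_monic _ _ fun φ hφ => (hS φ hφ).2.pow _
  have hmult (φ : (ZMod 2)[X]) (hφ : Irreducible φ) (hφm : φ.Monic) (j : ℕ) :
      multiplicity φ (g j) = ((Finset.range E).filter fun k => ν φ k = j + 1).card := by
    rw [multiplicity_prod_of_ne_zero hφ _ _ fun ψ hψ => pow_ne_zero _ (hS ψ hψ).1.ne_zero]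
    have h (ψ) (hψ : ψ ∈ S) := multiplicity_prime_pow hφ hφm (hS ψ hψ).1
      ((Finset.range E).filter fun k => ν ψ k = j + 1).card
    rw [Finset.sum_congr rfl h]
    have h' (ψ) (hψ : ψ ∈ S) : normalize ψ = ψ := (hS ψ hψ).2.normalize_eq_self
    rw [Finset.sum_congr rfl fun ψ hψ => by rw [h' ψ hψ]]
    rw [Finset.sum_ite_eq' S φ]
    split_ifs with hφS
    · rfl
    · symm
      rw [Finset.card_eq_zero, Finset.filter_eq_empty_iff]
      intro k _
      rw [hzero φ hφ hφm hφS]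
      omega
  have hN (j : ℕ) (hj : N ≤ j) : g j = 1 := by
    refine Finset.prod_eq_one fun φ hφ => ?_
    rw [Finset.card_eq_zero.2, pow_zero]
    rw [Finset.filter_eq_empty_iff]
    intro k _
    have h1 := hanti φ (hS φ hφ).1 (hS φ hφ).2 (Nat.zero_le k)
    have h2 := hle φ (hS φ hφ).1 (hS φ hφ).2
    omega
  refine ⟨g, hmon, hN, hmult, fun φ hφ hφm k => ?_⟩
  have hνN (l : ℕ) : ν φ l ≤ N := (hanti φ hφ hφm (Nat.zero_le l)).trans (hle φ hφ hφm)
  have htail (i : ℕ) : multiplicity φ (tailProd g N i) =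
      ((Finset.range E).filter fun l => i < ν φ l).card := by
    rw [tailProd, multiplicity_prod_of_ne_zero hφ _ _ fun j _ => (hmon j).ne_zero,
      Finset.sum_congr rfl fun j _ => hmult φ hφ hφm j,
      Finset.card_eq_sum_card_fiberwise (f := fun l => ν φ l - 1) (t := Finset.Ico i N)]
    · refine Finset.sum_congr rfl fun j hj => ?_
      rw [Finset.filter_filter]
      congr 1
      refine Finset.filter_congr fun l _ => ?_
      rw [Finset.mem_Ico] at hj
      omega
    · intro l hl
      have := hνN l
      simp only [Finset.coe_filter, Set.mem_ofPred_eq] at hl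
      simp only [Finset.coe_Ico, Set.mem_Ico]
      omega
  have hmin (i : ℕ) : min k (multiplicity φ (tailProd g N i)) =
      ∑ l ∈ Finset.range k, if i < ν φ l then 1 else 0 := by
    rw [← Finset.card_filter, htail]
    have : (Finset.range k).filter (fun l => i < ν φ l) =
        Finset.range (min k ((Finset.range E).filter fun l => i < ν φ l).card) := by
      ext l
      rw [Finset.mem_filter, Finset.mem_range, Finset.mem_range, lt_min_iff,
        lt_card_filter_range_iff (p := fun l => i < ν φ l)
          (fun a b hab hb => hb.trans_le (hanti φ hφ hφm hab))]
      intro l hl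
      rw [hE φ hφ hφm l hl]
      exact Nat.not_lt_zero _
    rw [this, Finset.card_range]
  rw [Finset.sum_congr rfl fun i _ => hmin i, Finset.sum_comm]
  refine Finset.sum_congr rfl fun l _ => ?_
  rw [← Finset.card_filter]
  have : (Finset.range N).filter (fun i => i < ν φ l) = Finset.range (ν φ l) := by
    ext i
    have := hνN l
    simp only [Finset.mem_filter, Finset.mem_range]
    omega
  rw [this, Finset.card_range]

end tailProd

/-! ### Matrices as modules, and the effect of squaring. -/

/-- The space of column vectors as a module over the polynomial ring, `X` acting as `A`. -/
abbrev MatrixModule {n : ℕ} (A : Matrix (Fin n) (Fin n) (ZMod 2)) : Type :=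
  Module.AEval' (Matrix.toLin' A)

section MatrixModule

variable {n : ℕ}

instance finite_matrixModule (A : Matrix (Fin n) (Fin n) (ZMod 2)) : Finite (MatrixModule A) :=
  Finite.of_equiv _ (Module.AEval'.of (Matrix.toLin' A)).toEquiv

theorem card_matrixModule (A : Matrix (Fin n) (Fin n) (ZMod 2)) :
    Nat.card (MatrixModule A) = 2 ^ n := by
  rw [← Nat.card_congr (Module.AEval'.of (Matrix.toLin' A)).toEquiv]
  simp

theorem matrixModule_equiv_of_isConj {A B : Matrix (Fin n) (Fin n) (ZMod 2)} (h : IsConj A B) :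
    Nonempty (MatrixModule A ≃ₗ[(ZMod 2)[X]] MatrixModule B) := by
  obtain ⟨c, hc⟩ := h
  let f : (Fin n → ZMod 2) ≃ₗ[ZMod 2] (Fin n → ZMod 2) :=
    Matrix.toLin'OfInv
      (M := ((c⁻¹ : (Matrix (Fin n) (Fin n) (ZMod 2))ˣ) : Matrix (Fin n) (Fin n) (ZMod 2)))
      (M' := (c : Matrix (Fin n) (Fin n) (ZMod 2))) c.inv_mul c.mul_inv
  refine ⟨LinearEquiv.ofAEval (Matrix.toLin' A)
    (f.trans (Module.AEval'.of (Matrix.toLin' B))) fun m => ?_⟩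
  change Module.AEval'.of (Matrix.toLin' B) (c.1.mulVec (A.mulVec m)) =
    (X : (ZMod 2)[X]) • Module.AEval'.of (Matrix.toLin' B) (c.1.mulVec m)
  rw [Module.AEval'.X_smul_of, Matrix.toLin'_apply, Matrix.mulVec_mulVec, Matrix.mulVec_mulVec,
    hc.eq]

theorem isConj_of_matrixModule_equiv {A B : Matrix (Fin n) (Fin n) (ZMod 2)}
    (E : MatrixModule A ≃ₗ[(ZMod 2)[X]] MatrixModule B) : IsConj A B := by
  let f : (Fin n → ZMod 2) ≃ₗ[ZMod 2] (Fin n → ZMod 2) :=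
    (Module.AEval'.of (Matrix.toLin' A)).trans
      ((E.restrictScalars (ZMod 2)).trans (Module.AEval'.of (Matrix.toLin' B)).symm)
  have hf (v : Fin n → ZMod 2) : f (Matrix.toLin' A v) = Matrix.toLin' B (f v) := by
    apply (Module.AEval'.of (Matrix.toLin' B)).injective
    rw [← Module.AEval'.X_smul_of]
    change (Module.AEval'.of (Matrix.toLin' B)) ((Module.AEval'.of (Matrix.toLin' B)).symm
      (E (Module.AEval'.of (Matrix.toLin' A) (Matrix.toLin' A v)))) =
      X • (Module.AEval'.of (Matrix.toLin' B)) ((Module.AEval'.of (Matrix.toLin' B)).symm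
      (E (Module.AEval'.of (Matrix.toLin' A) v)))
    rw [LinearEquiv.apply_symm_apply, LinearEquiv.apply_symm_apply, ← Module.AEval'.X_smul_of,
      map_smul]
  let c : (Matrix (Fin n) (Fin n) (ZMod 2))ˣ :=
    { val := LinearMap.toMatrix' f.toLinearMap
      inv := LinearMap.toMatrix' f.symm.toLinearMap
      val_inv := by rw [← LinearMap.toMatrix'_comp]; simp
      inv_val := by rw [← LinearMap.toMatrix'_comp]; simp }
  refine ⟨c, ?_⟩
  change LinearMap.toMatrix' f.toLinearMap * A = B * LinearMap.toMatrix' f.toLinearMap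
  apply Matrix.toLin'.injective
  rw [Matrix.toLin'_mul, Matrix.toLin'_mul, Matrix.toLin'_toMatrix']
  exact LinearMap.ext hf

theorem mem_torsionBy_matrixModule (A : Matrix (Fin n) (Fin n) (ZMod 2)) (p : (ZMod 2)[X])
    (v : Fin n → ZMod 2) :
    Module.AEval'.of (Matrix.toLin' A) v ∈ Submodule.torsionBy (ZMod 2)[X] (MatrixModule A) p ↔
      aeval (Matrix.toLin' A) p v = 0 := by
  rw [Submodule.mem_torsionBy_iff]
  exact Iff.rfl

theorem torsionCard_matrixModule (A : Matrix (Fin n) (Fin n) (ZMod 2)) (p : (ZMod 2)[X]) :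
    torsionCard (MatrixModule A) p =
      Nat.card {v : Fin n → ZMod 2 // aeval (Matrix.toLin' A) p v = 0} :=
  (Nat.card_congr ((Module.AEval'.of (Matrix.toLin' A)).toEquiv.subtypeEquiv fun v =>
    (mem_torsionBy_matrixModule A p v).symm)).symm

/-- Over `ZMod 2`, `p(A ^ 2) = p(X ^ 2)(A) = p(A) ^ 2`. -/
theorem torsionCard_matrixModule_sq (A : Matrix (Fin n) (Fin n) (ZMod 2)) (p : (ZMod 2)[X]) :
    torsionCard (MatrixModule (A ^ 2)) p = torsionCard (MatrixModule A) (p ^ 2) := by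
  have : Fact (Nat.Prime 2) := ⟨Nat.prime_two⟩
  rw [torsionCard_matrixModule, torsionCard_matrixModule, Matrix.toLin'_pow, ← expand_aeval,
    ZMod.expand_card]

theorem isUnit_iff_torsionCard (A : Matrix (Fin n) (Fin n) (ZMod 2)) :
    IsUnit A ↔ torsionCard (MatrixModule A) X = 1 := by
  rw [← Matrix.mulVec_injective_iff_isUnit, torsionCard_matrixModule, Nat.card_eq_one_iff_unique]
  simp only [aeval_X, Matrix.toLin'_apply]
  constructor
  · intro h
    refine ⟨⟨fun a b => Subtype.ext (h ?_)⟩, ⟨⟨0, Matrix.mulVec_zero A⟩⟩⟩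
    exact a.2.trans b.2.symm
  · rintro ⟨h, -⟩ v w hvw
    have h1 : A.mulVec (v - w) = 0 := by
      rw [Matrix.mulVec_sub, sub_eq_zero]
      exact hvw
    have := congrArg Subtype.val (h.elim ⟨v - w, h1⟩ ⟨0, Matrix.mulVec_zero A⟩)
    exact sub_eq_zero.1 this

theorem exists_matrixModule_equiv (M : Type) [AddCommGroup M] [Module (ZMod 2)[X] M]
    (hM : Nat.card M = 2 ^ n) :
    ∃ A : Matrix (Fin n) (Fin n) (ZMod 2), Nonempty (MatrixModule A ≃ₗ[(ZMod 2)[X]] M) := by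
  have : Finite M := Nat.finite_of_card_ne_zero (by rw [hM]; positivity)
  let _ : Module (ZMod 2) M := Module.compHom M (C : ZMod 2 →+* (ZMod 2)[X])
  have : IsScalarTower (ZMod 2) (ZMod 2)[X] M := ⟨fun r p m => by
    change (r • p) • m = C r • (p • m)
    rw [smul_eq_C_mul, mul_smul]⟩
  have : Module.Finite (ZMod 2) M := Module.Finite.of_finite
  have hrank : Module.finrank (ZMod 2) M = n := by
    have := Module.natCard_eq_pow_finrank (K := ZMod 2) (V := M)
    rw [hM, Nat.card_zmod] at this
    exact (Nat.pow_right_injective le_rfl this).symm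
  let f : (Fin n → ZMod 2) ≃ₗ[ZMod 2] M :=
    (Module.finBasisOfFinrankEq (ZMod 2) M hrank).equivFun.symm
  let T : (Fin n → ZMod 2) →ₗ[ZMod 2] (Fin n → ZMod 2) :=
    f.symm.toLinearMap ∘ₗ ((LinearMap.lsmul (ZMod 2)[X] M X).restrictScalars (ZMod 2)) ∘ₗ
      f.toLinearMap
  have hT (m : Fin n → ZMod 2) :
      f (Matrix.toLin' (LinearMap.toMatrix' T) m) = (X : (ZMod 2)[X]) • f m := by
    rw [Matrix.toLin'_toMatrix']
    exact f.apply_symm_apply _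
  exact ⟨LinearMap.toMatrix' T, ⟨LinearEquiv.ofAEval _ f hT⟩⟩

/-- Necessity of the conditions on the quotients of invariant factors of a square. -/
theorem exists_tail_of_sq {N : ℕ} (hN : n ≤ N) (A : Matrix (Fin n) (Fin n) (ZMod 2)) :
    ∃ g : ℕ → (ZMod 2)[X], (∀ j, (g j).Monic) ∧ (∀ j, N ≤ j → g j = 1) ∧
      (∀ j, Even j → Squarefree (g j)) ∧ (IsUnit A → ∀ j, ¬ X ∣ g j) ∧
      Nonempty (MatrixModule (A ^ 2) ≃ₗ[(ZMod 2)[X]] TailModule g N) := by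
  classical
  obtain ⟨ι, _, p, e, hp, he, ⟨D⟩⟩ := exists_equiv_pi_quotient (MatrixModule A)
  have hsum (φ : (ZMod 2)[X]) (k : ℕ) : ∑ l ∈ Finset.range (2 * k), blockCount p e φ l =
      ∑ l ∈ Finset.range k, (blockCount p e φ (2 * l) + blockCount p e φ (2 * l + 1)) := by
    induction k with
    | zero => simp
    | succ k ih =>
      rw [Finset.sum_range_succ, ← ih, mul_add, mul_one, Finset.sum_range_succ,
        Finset.sum_range_succ, add_assoc]
  have hanti (φ : (ZMod 2)[X]) : Antitone (blockCount p e φ) := fun a b hab =>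
    Finset.card_le_card (Finset.monotone_filter_right _ fun i _ hi => lt_of_le_of_lt hab hi)
  have hsq (φ : (ZMod 2)[X]) (hφ : Irreducible φ) (k : ℕ) :
      torsionCard (MatrixModule (A ^ 2)) (φ ^ k) = 2 ^ (φ.natDegree *
        ∑ l ∈ Finset.range k, (blockCount p e φ (2 * l) + blockCount p e φ (2 * l + 1))) := by
    rw [torsionCard_matrixModule_sq, ← pow_mul, torsionCard_eq_blockCount hp e D hφ, mul_comm k 2,
      hsum]
  have hzero (φ : (ZMod 2)[X]) (hφ : Irreducible φ) (hφm : φ.Monic)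
      (hφS : φ ∉ Finset.univ.image fun i => normalize (p i)) (k : ℕ) :
      blockCount p e φ k = 0 := by
    rw [blockCount, Finset.card_eq_zero, Finset.filter_eq_empty_iff]
    intro i _
    rw [multiplicity_prime_pow hφ hφm (hp i), if_neg]
    · exact Nat.not_lt_zero _
    · exact fun h => hφS (Finset.mem_image.2 ⟨i, Finset.mem_univ _, h⟩)
  have hbound (φ : (ZMod 2)[X]) (hφ : Irreducible φ) (hφm : φ.Monic) (k : ℕ)
      (hk : ∑ i, e i ≤ k) : blockCount p e φ k = 0 := by
    rw [blockCount, Finset.card_eq_zero, Finset.filter_eq_empty_iff]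
    intro i _
    have := Finset.single_le_sum (f := e) (fun i _ => Nat.zero_le _) (Finset.mem_univ i)
    rw [multiplicity_prime_pow hφ hφm (hp i)]
    split_ifs <;> omega
  obtain ⟨g, hmon, h1, hmult, hg⟩ := exists_tail_of_antitone (N := N)
    (Finset.univ.image fun i => normalize (p i)) (by
      intro φ hφ
      obtain ⟨i, -, rfl⟩ := Finset.mem_image.1 hφ
      exact ⟨(normalize_associated _).symm.irreducible (hp i), monic_normalize (hp i).ne_zero⟩)
    (fun φ l => blockCount p e φ (2 * l) + blockCount p e φ (2 * l + 1))
    (fun φ _ _ a b hab => Nat.add_le_add (hanti φ (by omega)) (hanti φ (by omega)))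
    (by
      intro φ hφ _
      -- The `φ`-torsion has at most `2 ^ n` elements, so `A ^ 2` has at most `n ≤ N` blocks at `φ`.
      have h2 := hsq φ hφ 1
      have h3 : torsionCard (MatrixModule (A ^ 2)) (φ ^ 1) ≤ 2 ^ n := by
        rw [← card_matrixModule (A ^ 2)]
        exact Nat.card_le_card_of_injective _ Subtype.val_injective
      rw [h2, Finset.sum_range_one] at h3
      have h4 := (Nat.pow_le_pow_iff_right (by norm_num)).1 h3
      exact ((Nat.le_mul_of_pos_left _ hφ.natDegree_pos).trans h4).trans hN)
    (fun φ hφ hφm hφS k => by rw [hzero φ hφ hφm hφS, hzero φ hφ hφm hφS])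
    (∑ i, e i)
    (fun φ hφ hφm k hk => by
      rw [hbound φ hφ hφm _ (by omega), hbound φ hφ hφm _ (by omega)])
  have hfin : Finite (TailModule g N) := finite_tailModule hmon
  refine ⟨g, hmon, h1, fun j hj => ?_, fun hA j hd => ?_,
    nonempty_equiv_of_torsionCard_eq _ _ fun φ hφ hφm k => ?_⟩
  · refine squarefree_of_multiplicity_le_one (hmon j).ne_zero fun φ hφ hφm => ?_
    rw [hmult φ hφ hφm, Finset.card_le_one]
    intro a ha b hb
    rw [Finset.mem_filter] at ha hb
    obtain ⟨m, rfl⟩ := hj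
    -- Four weakly decreasing numbers whose first two and last two have equal sums are all equal, so
    -- that common sum cannot be odd.
    have key (a b : ℕ) (hab : a < b)
        (ha : blockCount p e φ (2 * a) + blockCount p e φ (2 * a + 1) = m + m + 1)
        (hb : blockCount p e φ (2 * b) + blockCount p e φ (2 * b + 1) = m + m + 1) : False := by
      have h1 := hanti φ (show 2 * a ≤ 2 * a + 1 by omega)
      have h2 := hanti φ (show 2 * a + 1 ≤ 2 * b by omega)
      have h3 := hanti φ (show 2 * b ≤ 2 * b + 1 by omega)
      omega
    rcases lt_trichotomy a b with h | h | h
    · exact (key a b h ha.2 hb.2).elim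
    · exact h
    · exact (key b a h hb.2 ha.2).elim
  · have hA2 := (isUnit_iff_torsionCard _).1 (hA.pow 2)
    have h2 := hsq X irreducible_X 1
    rw [pow_one, hA2, natDegree_X, one_mul, Finset.sum_range_one] at h2
    have h3 : blockCount p e X (2 * 0) + blockCount p e X (2 * 0 + 1) = 0 := by
      by_contra h
      have := Nat.one_lt_two_pow h
      omega
    have h4 := (finiteMultiplicity_of_irreducible irreducible_X
      (hmon j).ne_zero).le_multiplicity_of_pow_dvd (k := 1) (by rwa [pow_one])
    rw [hmult X irreducible_X monic_X, Nat.one_le_iff_ne_zero, Finset.card_ne_zero] at h4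
    obtain ⟨k, hk⟩ := h4
    rw [Finset.mem_filter] at hk
    have h5 := hanti X (show 2 * 0 ≤ 2 * k by omega)
    have h6 := hanti X (show 2 * 0 ≤ 2 * k + 1 by omega)
    omega
  · rw [torsionCard_tailModule hmon hφ, hg φ hφ hφm, hsq φ hφ]

theorem sum_range_two_mul_tailProd {N : ℕ} (F : ℕ → ℕ) (hF : ∀ i, N ≤ i → F i = 0) :
    ∑ i ∈ Finset.range N, (F (2 * i) + F (2 * i + 1)) = ∑ i ∈ Finset.range N, F i := by
  have (k : ℕ) : ∑ i ∈ Finset.range k, (F (2 * i) + F (2 * i + 1)) =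
      ∑ i ∈ Finset.range (2 * k), F i := by
    induction k with
    | zero => simp
    | succ k ih =>
      rw [Finset.sum_range_succ, ih, mul_add, mul_one, Finset.sum_range_succ,
        Finset.sum_range_succ, add_assoc]
  rw [this]
  symm
  refine Finset.sum_subset (Finset.range_mono (by omega)) fun i _ hi => hF i ?_
  simpa using hi

/-- Sufficiency: with `d i` the `i`-th tail, a square root acts on the sum of the cyclic modules
modulo `d (2 * i) * d (2 * i + 1)`, since squaring splits each block into two nearly equal halves.
-/
theorem exists_sq_of_tail {N : ℕ} {g : ℕ → (ZMod 2)[X]} (hg : ∀ j, (g j).Monic)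
    (h1 : ∀ j, N ≤ j → g j = 1) (hsf : ∀ j, Even j → Squarefree (g j))
    (hn : ∑ j ∈ Finset.range N, (j + 1) * (g j).natDegree = n) :
    ∃ A : Matrix (Fin n) (Fin n) (ZMod 2), ((∀ j, ¬ X ∣ g j) → IsUnit A) ∧
      Nonempty (MatrixModule (A ^ 2) ≃ₗ[(ZMod 2)[X]] TailModule g N) := by
  have ht0 (i : ℕ) : tailProd g N i ≠ 0 := (monic_tailProd hg N i).ne_zero
  have hh0 (i : Fin N) : tailProd g N (2 * i) * tailProd g N (2 * i + 1) ≠ 0 :=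
    mul_ne_zero (ht0 _) (ht0 _)
  have hcard : Nat.card (∀ i : Fin N,
      (ZMod 2)[X] ⧸ Ideal.span {tailProd g N (2 * i) * tailProd g N (2 * i + 1)}) = 2 ^ n := by
    rw [card_pi_quotient (fun i : Fin N => tailProd g N (2 * i) * tailProd g N (2 * i + 1)) hh0,
      ← hn, ← sum_natDegree_tailProd hg,
      ← sum_range_two_mul_tailProd _ fun i hi => by rw [tailProd_eq_one hi, natDegree_one],
      Finset.sum_range]
    congr 1
    exact Finset.sum_congr rfl fun i _ => natDegree_mul (ht0 _) (ht0 _)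
  obtain ⟨A, ⟨D⟩⟩ := exists_matrixModule_equiv _ hcard
  have hfin : Finite (TailModule g N) := finite_tailModule hg
  have htors (φ : (ZMod 2)[X]) (hφ : Irreducible φ) (k : ℕ) :
      torsionCard (MatrixModule (A ^ 2)) (φ ^ k) = torsionCard (TailModule g N) (φ ^ k) := by
    rw [torsionCard_matrixModule_sq, ← pow_mul, torsionCard_congr D, torsionCard_pi_quotient hφ
      (fun i : Fin N => tailProd g N (2 * i) * tailProd g N (2 * i + 1)) hh0,
      torsionCard_tailModule hg hφ, ← sum_range_two_mul_tailProd _ fun i hi => by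
        rw [tailProd_eq_one hi, multiplicity_one_of_irreducible hφ, Nat.min_zero],
      Finset.sum_range]
    congr 2
    refine Finset.sum_congr rfl fun i _ => ?_
    -- As `g (2 * i)` is squarefree, the multiplicities `a`, `b` of `φ` in the two tails satisfy `b
    -- ≤ a ≤ b + 1`; hence `min (2 * k) (a + b) = min k a + min k b`.
    have h2 := multiplicity_le_one_of_squarefree hφ (hsf (2 * i) (even_two_mul _))
    rw [multiplicity_mul_of_ne_zero hφ (ht0 _) (ht0 _), tailProd_eq_mul h1 (2 * i),
      multiplicity_mul_of_ne_zero hφ (hg _).ne_zero (ht0 _)]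
    omega
  refine ⟨A, fun hX => ?_, nonempty_equiv_of_torsionCard_eq _ _ fun φ hφ _ k => htors φ hφ k⟩
  have hu : IsUnit (A ^ 2) := by
    rw [isUnit_iff_torsionCard, ← pow_one X, htors X irreducible_X,
      torsionCard_tailModule hg irreducible_X, Finset.sum_eq_zero, mul_zero, pow_zero]
    intro i _
    rw [tailProd, multiplicity_prod_of_ne_zero irreducible_X _ _ fun j _ => (hg j).ne_zero,
      Finset.sum_eq_zero fun j _ => multiplicity_eq_zero.2 (hX j), Nat.min_zero]
  exact (isUnit_pow_iff two_ne_zero).1 hu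

end MatrixModule

/-! ### Bijection between classes of squares and sequences of allowed factors. -/

/-- The monic polynomials that are allowed as quotients of consecutive invariant factors of a
square: squarefree ones at even places, and not divisible by `X` if `b` holds. -/
abbrev AllowedFactor (b : Prop) (j : ℕ) : Type :=
  {f : (ZMod 2)[X] // f.Monic ∧ (b → ¬ X ∣ f) ∧ (Even j → Squarefree f)}

/-- Extension of a finite family of allowed polynomials by `1`. -/
noncomputable def extendByOne {b : Prop} {N : ℕ} (x : ∀ j : Fin N, AllowedFactor b j) (j : ℕ) :
    (ZMod 2)[X] :=
  if h : j < N then (x ⟨j, h⟩).1 else 1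

section extendByOne

variable {b : Prop} {N : ℕ} (x : ∀ j : Fin N, AllowedFactor b j)

theorem extendByOne_coe (j : Fin N) : extendByOne x j = (x j).1 := dif_pos j.2

theorem extendByOne_of_le {j : ℕ} (h : N ≤ j) : extendByOne x j = 1 := dif_neg (by omega)

theorem extendByOne_spec (j : ℕ) : (extendByOne x j).Monic ∧ (b → ¬ X ∣ extendByOne x j) ∧
    (Even j → Squarefree (extendByOne x j)) := by
  rcases lt_or_ge j N with h | h
  · exact extendByOne_coe x ⟨j, h⟩ ▸ (x ⟨j, h⟩).2
  · rw [extendByOne_of_le x h]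
    exact ⟨monic_one, fun _ h => not_isUnit_X (isUnit_of_dvd_one h), fun _ => squarefree_one⟩

theorem sum_natDegree_extendByOne :
    ∑ j ∈ Finset.range N, (j + 1) * (extendByOne x j).natDegree =
      ∑ j : Fin N, ((j : ℕ) + 1) * (x j).1.natDegree := by
  rw [Finset.sum_range]
  exact Finset.sum_congr rfl fun j _ => by rw [extendByOne_coe]

end extendByOne

/-- The proposition `b` treats all matrices (`False`) and invertible ones (`True`) together. Any
length `N ≥ n` works, which later lets `N` tend to infinity. -/
theorem ncard_squareClasses (b : Prop) {n N : ℕ} (hN : n ≤ N) :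
    Set.ncard {c : ConjClasses (Matrix (Fin n) (Fin n) (ZMod 2)) |
      ∃ A : Matrix (Fin n) (Fin n) (ZMod 2), (b → IsUnit A) ∧ c = ConjClasses.mk (A ^ 2)} =
    Nat.card {x : ∀ j : Fin N, AllowedFactor b j //
      ∑ j : Fin N, ((j : ℕ) + 1) * (x j).1.natDegree = n} := by
  rw [← Nat.card_coe_set_eq]
  symm
  have key (x : {x : ∀ j : Fin N, AllowedFactor b j //
      ∑ j : Fin N, ((j : ℕ) + 1) * (x j).1.natDegree = n}) :=
    exists_sq_of_tail (N := N) (fun j => (extendByOne_spec x.1 j).1)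
      (fun j => extendByOne_of_le x.1) (fun j => (extendByOne_spec x.1 j).2.2)
      ((sum_natDegree_extendByOne x.1).trans x.2)
  choose A hA hE using key
  refine Nat.card_eq_of_bijective (fun x => ⟨ConjClasses.mk (A x ^ 2), A x,
    fun hb => hA x fun j => (extendByOne_spec x.1 j).2.1 hb, rfl⟩) ⟨fun x y hxy => ?_, ?_⟩
  · have h1 : IsConj (A x ^ 2) (A y ^ 2) :=
      ConjClasses.mk_eq_mk_iff_isConj.1 (congrArg Subtype.val hxy)
    obtain ⟨D⟩ := matrixModule_equiv_of_isConj h1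
    obtain ⟨Ex⟩ := hE x
    obtain ⟨Ey⟩ := hE y
    have h2 := eq_of_tailModule_equiv (fun j => (extendByOne_spec x.1 j).1)
      (fun j => extendByOne_of_le x.1) (fun j => (extendByOne_spec y.1 j).1)
      (fun j => extendByOne_of_le y.1) (Ex.symm.trans (D.trans Ey))
    refine Subtype.ext (funext fun j => Subtype.ext ?_)
    rw [← extendByOne_coe, ← extendByOne_coe, h2]
  · rintro ⟨c, B, hB, rfl⟩
    obtain ⟨g, hg, h1, hsf, hX, ⟨D⟩⟩ := exists_tail_of_sq hN B
    let x : ∀ j : Fin N, AllowedFactor b j := fun j =>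
      ⟨g j, hg j, fun hb => hX (hB hb) j, hsf j⟩
    have hx : extendByOne x = g := by
      funext j
      rcases lt_or_ge j N with h | h
      · exact extendByOne_coe x ⟨j, h⟩
      · rw [extendByOne_of_le x h, h1 j h]
    have hsum : ∑ j : Fin N, ((j : ℕ) + 1) * (x j).1.natDegree = n := by
      rw [← sum_natDegree_extendByOne, hx]
      have h2 := Nat.card_congr D.toEquiv
      rw [card_matrixModule, card_tailModule hg] at h2
      exact (Nat.pow_right_injective le_rfl h2).symm
    refine ⟨⟨x, hsum⟩, Subtype.ext (ConjClasses.mk_eq_mk_iff_isConj.2 ?_)⟩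
    obtain ⟨E⟩ := hE ⟨x, hsum⟩
    rw [hx] at E
    exact isConj_of_matrixModule_equiv (E.trans D.symm)

theorem squareClassesMat_eq {n N : ℕ} (hN : n ≤ N) :
    squareClassesMat n = Nat.card {x : ∀ j : Fin N, AllowedFactor False j //
      ∑ j : Fin N, ((j : ℕ) + 1) * (x j).1.natDegree = n} := by
  rw [← ncard_squareClasses False hN]
  simp [squareClassesMat, numSquareClasses]

/-- Conjugacy in a monoid is by units, so classes of `GL` can be counted inside the matrix monoid.
-/
theorem map_units_coeHom_injective (M : Type*) [Monoid M] :
    Function.Injective (ConjClasses.map (Units.coeHom M)) := by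
  intro c d h
  obtain ⟨x, rfl⟩ := ConjClasses.exists_rep c
  obtain ⟨y, rfl⟩ := ConjClasses.exists_rep d
  obtain ⟨u, hu⟩ : IsConj (x : M) (y : M) := ConjClasses.mk_eq_mk_iff_isConj.1 h
  refine ConjClasses.mk_eq_mk_iff_isConj.2 (isConj_iff.2 ⟨u, ?_⟩)
  rw [mul_inv_eq_iff_eq_mul]
  exact Units.ext hu

theorem squareClassesGL_eq {n N : ℕ} (hN : n ≤ N) :
    squareClassesGL n = Nat.card {x : ∀ j : Fin N, AllowedFactor True j //
      ∑ j : Fin N, ((j : ℕ) + 1) * (x j).1.natDegree = n} := by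
  rw [← ncard_squareClasses True hN, squareClassesGL, numSquareClasses,
    ← Set.ncard_image_of_injective _ (map_units_coeHom_injective _)]
  congr 1
  ext c
  constructor
  · rintro ⟨_, ⟨x, rfl⟩, rfl⟩
    exact ⟨x.1, fun _ => x.isUnit, rfl⟩
  · rintro ⟨A, hA, rfl⟩
    obtain ⟨u, rfl⟩ := hA trivial
    exact ⟨_, ⟨u, rfl⟩, rfl⟩

/-! ### Generating functions of weighted sets. -/

section weightGF

/-- The generating function of a weighted set. -/
noncomputable def weightGF {α : Type*} (w : α → ℕ) : PowerSeries ℤ :=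
  PowerSeries.mk fun n => (Nat.card {a // w a = n} : ℤ)

theorem weightGF_congr {α β : Type*} {w : α → ℕ} {v : β → ℕ} (e : α ≃ β)
    (h : ∀ a, v (e a) = w a) : weightGF w = weightGF v := by
  ext n
  rw [weightGF, weightGF, PowerSeries.coeff_mk, PowerSeries.coeff_mk,
    Nat.card_congr (e.subtypeEquiv (q := fun b => v b = n) fun a => by rw [h])]

/-- The elements of given weight in a product. -/
def fiberProdEquiv {α β : Type*} (w : α → ℕ) (v : β → ℕ) (n : ℕ) :
    {x : α × β // w x.1 + v x.2 = n} ≃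
      Σ p : Finset.HasAntidiagonal.antidiagonal n, {a // w a = p.1.1} × {b // v b = p.1.2} where
  toFun x := ⟨⟨(w x.1.1, v x.1.2),
    Finset.HasAntidiagonal.mem_antidiagonal.2 x.2⟩, ⟨x.1.1, rfl⟩, ⟨x.1.2, rfl⟩⟩
  invFun y := ⟨(y.2.1.1, y.2.2.1), by
    rw [y.2.1.2, y.2.2.2]
    exact Finset.HasAntidiagonal.mem_antidiagonal.1 y.1.2⟩
  left_inv _ := rfl
  right_inv := by
    rintro ⟨⟨⟨_, _⟩, _⟩, ⟨_, h1⟩, ⟨_, h2⟩⟩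
    dsimp only at h1 h2
    subst h1 h2
    rfl

theorem finite_fiber_prod {α β : Type*} {w : α → ℕ} {v : β → ℕ}
    (hw : ∀ n, Finite {a // w a = n}) (hv : ∀ n, Finite {b // v b = n}) (n : ℕ) :
    Finite {x : α × β // w x.1 + v x.2 = n} :=
  Finite.of_equiv _ (fiberProdEquiv w v n).symm

theorem weightGF_prod {α β : Type*} {w : α → ℕ} {v : β → ℕ}
    (hw : ∀ n, Finite {a // w a = n}) (hv : ∀ n, Finite {b // v b = n}) :
    weightGF (fun x : α × β => w x.1 + v x.2) = weightGF w * weightGF v := by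
  ext n
  rw [PowerSeries.coeff_mul, weightGF, PowerSeries.coeff_mk, Nat.card_congr (fiberProdEquiv w v n),
    Nat.card_sigma, Finset.sum_coe_sort (Finset.HasAntidiagonal.antidiagonal n)
      (fun p => Nat.card ({a // w a = p.1} × {b // v b = p.2}))]
  push_cast
  refine Finset.sum_congr rfl fun p _ => ?_
  rw [Nat.card_prod, weightGF, weightGF, PowerSeries.coeff_mk, PowerSeries.coeff_mk, Nat.cast_mul]

/-- Finiteness of the fibres is carried through the induction because `Nat.card` is `0` on infinite
types. -/
theorem weightGF_pi {N : ℕ} (α : ℕ → Type*) (w : ∀ j, α j → ℕ)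
    (hw : ∀ j n, Finite {a // w j a = n}) :
    (∀ n, Finite {x : ∀ j : Fin N, α j // ∑ j : Fin N, w j (x j) = n}) ∧
      weightGF (fun x : ∀ j : Fin N, α j => ∑ j : Fin N, w j (x j)) =
        ∏ j ∈ Finset.range N, weightGF (w j) := by
  induction N with
  | zero =>
    refine ⟨fun n => inferInstance, ?_⟩
    ext n
    rw [Finset.range_zero, Finset.prod_empty, PowerSeries.coeff_one, weightGF, PowerSeries.coeff_mk]
    split_ifs with h
    · subst h
      simp
    · have : IsEmpty {x : ∀ j : Fin 0, α j // ∑ j : Fin 0, w j (x j) = n} :=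
        ⟨fun x => h (x.2.symm.trans (by simp))⟩
      rw [Nat.card_of_isEmpty, Nat.cast_zero]
  | succ N ih =>
    let e : (α N × ∀ j : Fin N, α j) ≃ ∀ j : Fin (N + 1), α j :=
      Fin.snocEquiv (n := N) fun j => α j
    have he (x : α N × (∀ j : Fin N, α j)) :
        ∑ j : Fin (N + 1), w j (e x j) = w N x.1 + ∑ j : Fin N, w j (x.2 j) := by
      rw [Fin.sum_univ_castSucc, add_comm]
      simp [e]
    constructor
    · intro n
      have := finite_fiber_prod (hw N) ih.1 n
      exact Finite.of_equiv {x : α N × ∀ j : Fin N, α j // w N x.1 + ∑ j : Fin N, w j (x.2 j) = n}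
        (e.subtypeEquiv (p := fun x => w N x.1 + ∑ j : Fin N, w j (x.2 j) = n)
        fun a => by rw [he])
    · rw [Finset.prod_range_succ, ← ih.2, mul_comm, ← weightGF_prod (hw N) ih.1]
      exact (weightGF_congr e he).symm

theorem card_mul_fiber {α : Type*} (w : α → ℕ) (c k : ℕ) (hk : k ≠ 0)
    (hw : ∀ m, Nat.card {a // w a = m} = c ^ m) (n : ℕ) :
    Nat.card {a // k * w a = n} = if k ∣ n then c ^ (n / k) else 0 := by
  split_ifs with h
  · obtain ⟨m, rfl⟩ := h
    rw [Nat.mul_div_cancel_left _ (Nat.pos_of_ne_zero hk), ← hw]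
    exact Nat.card_congr (Equiv.subtypeEquivRight fun a => Nat.mul_right_inj hk)
  · have : IsEmpty {a // k * w a = n} := ⟨fun a => h ⟨_, a.2.symm⟩⟩
    exact Nat.card_of_isEmpty

theorem weightGF_mul_one_sub {α : Type*} (w : α → ℕ) (c k : ℕ) (hk : k ≠ 0)
    (hw : ∀ m, Nat.card {a // w a = m} = c ^ m) :
    weightGF (fun a => k * w a) * (1 - (c : PowerSeries ℤ) * PowerSeries.X ^ k) = 1 := by
  have hcoeff := card_mul_fiber w c k hk hw
  ext n
  rw [mul_sub, mul_one, map_sub, mul_left_comm, ← mul_assoc, mul_assoc,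
    ← map_natCast (PowerSeries.C (R := ℤ)), PowerSeries.coeff_C_mul, PowerSeries.coeff_mul_X_pow',
    weightGF, PowerSeries.coeff_mk, PowerSeries.coeff_mk, PowerSeries.coeff_one, hcoeff, hcoeff]
  rcases Nat.eq_zero_or_pos n with rfl | hn
  · simp [hk]
  · rw [if_neg (by omega : ¬ n = 0)]
    rcases lt_or_ge n k with h | h
    · rw [if_neg fun hd => absurd (Nat.le_of_dvd hn hd) (by omega), if_neg (by omega)]
      simp
    · obtain ⟨m, rfl⟩ := Nat.exists_eq_add_of_le h
      rw [if_pos h, Nat.add_sub_cancel_left, Nat.add_div_left _ (Nat.pos_of_ne_zero hk)]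
      simp only [Nat.dvd_add_right (dvd_refl k)]
      split_ifs <;> simp [pow_succ, mul_comm]

end weightGF

/-! ### Counting monic and squarefree polynomials over `ZMod 2`. -/

/-- Monic polynomials, not divisible by `X` if `b` holds. -/
abbrev MonicPoly (b : Prop) : Type := {f : (ZMod 2)[X] // f.Monic ∧ (b → ¬ X ∣ f)}

/-- Squarefree monic polynomials, not divisible by `X` if `b` holds. -/
abbrev SquarefreePoly (b : Prop) : Type :=
  {f : (ZMod 2)[X] // f.Monic ∧ (b → ¬ X ∣ f) ∧ Squarefree f}

theorem card_monic_natDegree_eq (m : ℕ) :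
    Nat.card {f : (ZMod 2)[X] // f.Monic ∧ f.natDegree = m} = 2 ^ m := by
  rw [Nat.card_congr (monicEquivDegreeLT m), Nat.card_congr (degreeLTEquiv (ZMod 2) m).toEquiv]
  simp

theorem finite_natDegree_fiber {P : (ZMod 2)[X] → Prop} (hP : ∀ f, P f → f.Monic) {k : ℕ}
    (hk : k ≠ 0) (n : ℕ) : Finite {f : {f // P f} // k * f.1.natDegree = n} := by
  have : Finite {f : (ZMod 2)[X] // f.Monic ∧ f.natDegree = n / k} :=
    Nat.finite_of_card_ne_zero (by rw [card_monic_natDegree_eq]; positivity)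
  refine Finite.of_injective (β := {f : (ZMod 2)[X] // f.Monic ∧ f.natDegree = n / k})
    (fun f => ⟨f.1.1, hP _ f.1.2, ?_⟩) ?_
  · exact (Nat.div_eq_of_eq_mul_right (Nat.pos_of_ne_zero hk) f.2.symm).symm
  · intro f g h
    exact Subtype.ext (Subtype.ext (Subtype.mk.inj h))

/-- The generating function of monic polynomials. -/
noncomputable def monicGF (b : Prop) (k : ℕ) : PowerSeries ℤ :=
  weightGF fun f : MonicPoly b => k * f.1.natDegree

/-- The generating function of squarefree monic polynomials. -/
noncomputable def squarefreeGF (b : Prop) (k : ℕ) : PowerSeries ℤ :=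
  weightGF fun f : SquarefreePoly b => k * f.1.natDegree

theorem card_monicPoly_natDegree_eq (m : ℕ) :
    Nat.card {f : MonicPoly False // f.1.natDegree = m} = 2 ^ m := by
  rw [← card_monic_natDegree_eq]
  refine Nat.card_congr ((Equiv.subtypeSubtypeEquivSubtypeInter
    (fun f : (ZMod 2)[X] => f.Monic ∧ (False → ¬ X ∣ f)) (fun f => f.natDegree = m)).trans
    (Equiv.subtypeEquivRight fun f => ?_))
  simp

theorem monicGF_false {k : ℕ} (hk : k ≠ 0) :
    monicGF False k * (1 - 2 * PowerSeries.X ^ k) = 1 :=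
  weightGF_mul_one_sub (fun f : MonicPoly False => f.1.natDegree) 2 k hk
    card_monicPoly_natDegree_eq

/-- Every monic polynomial is uniquely `f * X ^ m` with `X` not dividing `f`. -/
theorem monicGF_false_eq {k : ℕ} (hk : k ≠ 0) :
    monicGF False k = monicGF True k * weightGF (fun m : ℕ => k * m) := by
  rw [monicGF, monicGF, ← weightGF_prod (finite_natDegree_fiber (fun f hf => hf.1) hk)]
  · symm
    refine weightGF_congr (Equiv.ofBijective (fun x => ⟨x.1.1 * X ^ x.2,
      x.1.2.1.mul (monic_X_pow _), False.elim⟩) ⟨?_, ?_⟩) ?_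
    · rintro ⟨⟨f, hf, hfX⟩, m⟩ ⟨⟨g, hg, hgX⟩, l⟩ h
      have h1 : f * X ^ m = g * X ^ l := congrArg Subtype.val h
      have hm := congrArg (multiplicity X) h1
      rw [multiplicity_mul_of_ne_zero irreducible_X hf.ne_zero (pow_ne_zero _ X_ne_zero),
        multiplicity_mul_of_ne_zero irreducible_X hg.ne_zero (pow_ne_zero _ X_ne_zero),
        multiplicity_eq_zero.2 (hfX trivial), multiplicity_eq_zero.2 (hgX trivial),
        multiplicity_pow_self_of_prime prime_X, multiplicity_pow_self_of_prime prime_X] at hm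
      have hml : m = l := by omega
      subst hml
      have := mul_right_cancel₀ (pow_ne_zero m X_ne_zero) h1
      subst this
      rfl
    · rintro ⟨f, hf, -⟩
      obtain ⟨c, hc, hcX⟩ := (finiteMultiplicity_of_irreducible irreducible_X
        hf.ne_zero).exists_eq_pow_mul_and_not_dvd
      have hcm : c.Monic := (monic_X_pow (multiplicity X f)).of_mul_monic_left (hc ▸ hf)
      exact ⟨⟨⟨c, hcm, fun _ => hcX⟩, multiplicity X f⟩,
        Subtype.ext ((mul_comm _ _).trans hc.symm)⟩
    · rintro ⟨f, m⟩
      change k * (f.1 * X ^ m).natDegree = k * f.1.natDegree + k * m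
      rw [f.2.1.natDegree_mul (monic_X_pow m), natDegree_X_pow, mul_add]
  · intro n
    exact Finite.of_injective (β := Fin (n + 1)) (fun m => ⟨m.1, by
      have := Nat.le_mul_of_pos_left m.1 (Nat.pos_of_ne_zero hk)
      have := m.2
      omega⟩) fun a b h => Subtype.ext (by simpa using h)

theorem one_sub_mul_X_pow_ne_zero (c : PowerSeries ℤ) {k : ℕ} (hk : k ≠ 0) :
    1 - c * PowerSeries.X ^ k ≠ 0 := fun h => by
  simpa [hk] using congrArg PowerSeries.constantCoeff h

theorem one_sub_X_pow_ne_zero {k : ℕ} (hk : k ≠ 0) :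
    1 - (PowerSeries.X : PowerSeries ℤ) ^ k ≠ 0 := by
  simpa using one_sub_mul_X_pow_ne_zero 1 hk

theorem monicGF_true {k : ℕ} (hk : k ≠ 0) :
    monicGF True k * (1 - 2 * PowerSeries.X ^ k) = 1 - PowerSeries.X ^ k := by
  have h1 := monicGF_false hk
  have h2 : weightGF (fun m : ℕ => k * m) * (1 - PowerSeries.X ^ k) = 1 := by
    simpa using weightGF_mul_one_sub (fun m : ℕ => m) 1 k hk fun m => by simp
  rw [monicGF_false_eq hk] at h1
  linear_combination (1 - PowerSeries.X ^ k) * h1 -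
    monicGF True k * (1 - 2 * PowerSeries.X ^ k) * h2

theorem exists_eq_squarefree_mul_sq (f : (ZMod 2)[X]) (hf : f.Monic) :
    ∃ s t : (ZMod 2)[X], s.Monic ∧ t.Monic ∧ Squarefree s ∧ s * t ^ 2 = f := by
  classical
  induction h : f.natDegree using Nat.strong_induction_on generalizing f with
  | _ n ih =>
    by_cases hsf : Squarefree f
    · exact ⟨f, 1, hf, monic_one, hsf, by simp⟩
    · rw [squarefree_iff_no_irreducibles hf.ne_zero] at hsf
      push Not at hsf
      obtain ⟨p, hp, hd⟩ := hsf
      have hass := normalize_associated p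
      have hq : (normalize p).Monic := monic_normalize hp.ne_zero
      obtain ⟨c, hc⟩ := ((hass.mul_mul hass).dvd).trans hd
      have hcm : c.Monic := (hq.mul hq).of_mul_monic_left (hc ▸ hf)
      have hdeg : f.natDegree =
          (normalize p).natDegree + (normalize p).natDegree + c.natDegree := by
        rw [hc, (hq.mul hq).natDegree_mul hcm, hq.natDegree_mul hq]
      have hpos := (hass.symm.irreducible hp).natDegree_pos
      obtain ⟨s, t, hs, ht, hsf, rfl⟩ := ih c.natDegree (by omega) c hcm rfl
      exact ⟨s, t * normalize p, hs, ht.mul hq, hsf, by rw [hc]; ring⟩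

/-- Every monic polynomial is uniquely `s * t ^ 2` with `s` squarefree: at each prime, `s` takes the
parity of the multiplicity and `t` half of the rest. -/
theorem squarefreeGF_mul_monicGF (b : Prop) {k : ℕ} (hk : k ≠ 0) :
    squarefreeGF b k * monicGF b (2 * k) = monicGF b k := by
  rw [monicGF, squarefreeGF, ← weightGF_prod (finite_natDegree_fiber (fun f hf => hf.1) hk)
    (finite_natDegree_fiber (fun f hf => hf.1) (by omega))]
  refine weightGF_congr (Equiv.ofBijective (fun x => ⟨x.1.1 * x.2.1 ^ 2,
      x.1.2.1.mul (x.2.2.1.pow 2), fun hb hd => ?_⟩) ⟨?_, ?_⟩) ?_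
  · rcases prime_X.dvd_or_dvd hd with h | h
    · exact x.1.2.2.1 hb h
    · exact x.2.2.2 hb (prime_X.dvd_of_dvd_pow h)
  · rintro ⟨⟨s, hs, hsX, hsf⟩, ⟨t, ht, htX⟩⟩ ⟨⟨s', hs', hsX', hsf'⟩, ⟨t', ht', htX'⟩⟩ h
    have h1 : s * t ^ 2 = s' * t' ^ 2 := congrArg Subtype.val h
    have h2 : t = t' := by
      refine eq_of_multiplicity_eq ht ht' fun φ hφ _ => ?_
      have hm := congrArg (multiplicity φ) h1
      rw [sq, sq, multiplicity_mul_of_ne_zero hφ hs.ne_zero (mul_ne_zero ht.ne_zero ht.ne_zero),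
        multiplicity_mul_of_ne_zero hφ hs'.ne_zero (mul_ne_zero ht'.ne_zero ht'.ne_zero),
        multiplicity_mul_of_ne_zero hφ ht.ne_zero ht.ne_zero,
        multiplicity_mul_of_ne_zero hφ ht'.ne_zero ht'.ne_zero] at hm
      have := multiplicity_le_one_of_squarefree hφ hsf
      have := multiplicity_le_one_of_squarefree hφ hsf'
      omega
    subst h2
    have := mul_right_cancel₀ (pow_ne_zero 2 ht.ne_zero) h1
    subst this
    rfl
  · rintro ⟨f, hf, hfX⟩
    obtain ⟨s, t, hs, ht, hsf, rfl⟩ := exists_eq_squarefree_mul_sq f hf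
    exact ⟨⟨⟨s, hs, fun hb hd => hfX hb (hd.mul_right _), hsf⟩,
      ⟨t, ht, fun hb hd => hfX hb ((hd.trans (dvd_pow_self t two_ne_zero)).mul_left _)⟩⟩, rfl⟩
  · rintro ⟨s, t⟩
    change k * (s.1 * t.1 ^ 2).natDegree = k * s.1.natDegree + 2 * k * t.1.natDegree
    rw [s.2.1.natDegree_mul (t.2.1.pow 2), t.2.1.natDegree_pow]
    ring

theorem squarefreeGF_false {k : ℕ} (hk : k ≠ 0) :
    squarefreeGF False k * (1 - 2 * PowerSeries.X ^ k) = 1 - 2 * PowerSeries.X ^ (2 * k) := by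
  have h1 := squarefreeGF_mul_monicGF False hk
  have h2 := monicGF_false hk
  have h3 := monicGF_false (k := 2 * k) (by omega)
  rw [← h1] at h2
  linear_combination (1 - 2 * PowerSeries.X ^ (2 * k)) * h2 -
    squarefreeGF False k * (1 - 2 * PowerSeries.X ^ k) * h3

theorem squarefreeGF_true {k : ℕ} (hk : k ≠ 0) :
    squarefreeGF True k * ((1 - 2 * PowerSeries.X ^ k) * (1 + PowerSeries.X ^ k)) =
      1 - 2 * PowerSeries.X ^ (2 * k) := by
  have h1 := squarefreeGF_mul_monicGF True hk
  have h2 := monicGF_true hk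
  have h3 := monicGF_true (k := 2 * k) (by omega)
  rw [← h1] at h2
  -- The factor `1 + X ^ k` arises from `1 - X ^ (2 * k) = (1 - X ^ k) * (1 + X ^ k)`.
  apply mul_right_cancel₀ (one_sub_X_pow_ne_zero hk)
  rw [pow_mul', sq] at h3 ⊢
  linear_combination (1 - 2 * (PowerSeries.X ^ k * PowerSeries.X ^ k)) * h2 -
    squarefreeGF True k * (1 - 2 * PowerSeries.X ^ k) * h3

/-- The generating function of the possible `j`-th quotients of invariant factors. -/
noncomputable def factorGF (b : Prop) (j : ℕ) : PowerSeries ℤ :=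
  weightGF fun f : AllowedFactor b j => (j + 1) * f.1.natDegree

theorem factorGF_of_even (b : Prop) {j : ℕ} (hj : Even j) :
    factorGF b j = squarefreeGF b (j + 1) :=
  weightGF_congr (Equiv.subtypeEquivRight fun f => by simp [hj]) fun _ => rfl

theorem factorGF_of_odd (b : Prop) {j : ℕ} (hj : Odd j) : factorGF b j = monicGF b (j + 1) :=
  weightGF_congr (Equiv.subtypeEquivRight fun f => by simp [Nat.not_even_iff_odd.2 hj]) fun _ => rfl

theorem coeff_factorGF_nonneg (b : Prop) (j n : ℕ) : 0 ≤ PowerSeries.coeff n (factorGF b j) := by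
  rw [factorGF, weightGF, PowerSeries.coeff_mk]
  positivity

theorem coeff_factorGF_le (b : Prop) (j n : ℕ) :
    PowerSeries.coeff n (factorGF b j) ≤ PowerSeries.coeff n (factorGF False j) := by
  rw [factorGF, weightGF, PowerSeries.coeff_mk, factorGF, weightGF, PowerSeries.coeff_mk]
  have : Finite {f : AllowedFactor False j // (j + 1) * f.1.natDegree = n} :=
    finite_natDegree_fiber (fun f hf => hf.1) (Nat.succ_ne_zero j) n
  refine Nat.cast_le.2 (Nat.card_le_card_of_injective
    (fun f => ⟨⟨f.1.1, f.1.2.1, False.elim, f.1.2.2.2⟩, f.2⟩) fun f g h => ?_)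
  exact Subtype.ext (Subtype.ext (Subtype.mk.inj (Subtype.mk.inj h)))

theorem coeff_factorGF_of_lt (b : Prop) {j n : ℕ} (h : n < j + 1) :
    PowerSeries.coeff n (factorGF b j) = if n = 0 then 1 else 0 := by
  rw [factorGF, weightGF, PowerSeries.coeff_mk]
  have hdeg (f : {f : AllowedFactor b j // (j + 1) * f.1.natDegree = n}) : f.1.1 = 1 ∧ n = 0 := by
    have h0 : f.1.1.natDegree = 0 := by
      by_contra h0
      have := Nat.le_mul_of_pos_right (j + 1) (Nat.pos_of_ne_zero h0)
      have := f.2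
      omega
    refine ⟨f.1.2.1.natDegree_eq_zero.1 h0, ?_⟩
    rw [← f.2, h0, mul_zero]
  split_ifs with hn
  · subst hn
    have : Unique {f : AllowedFactor b j // (j + 1) * f.1.natDegree = 0} :=
      { default := ⟨⟨1, monic_one, fun _ h => not_isUnit_X (isUnit_of_dvd_one h),
          fun _ => squarefree_one⟩, by simp⟩
        uniq := fun f => Subtype.ext (Subtype.ext (hdeg f).1) }
    rw [Nat.card_unique, Nat.cast_one]
  · have : IsEmpty {f : AllowedFactor b j // (j + 1) * f.1.natDegree = n} :=
      ⟨fun f => hn (hdeg f).2⟩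
    rw [Nat.card_of_isEmpty, Nat.cast_zero]

theorem coeff_prod_factorGF (b : Prop) (N n : ℕ) :
    PowerSeries.coeff n (∏ j ∈ Finset.range N, factorGF b j) =
      (Nat.card {x : ∀ j : Fin N, AllowedFactor b j //
        ∑ j : Fin N, ((j : ℕ) + 1) * (x j).1.natDegree = n} : ℤ) := by
  have := (weightGF_pi (N := N) (AllowedFactor b) (fun j f => (j + 1) * f.1.natDegree)
    fun j => finite_natDegree_fiber (fun f hf => hf.1) (Nat.succ_ne_zero j)).2
  simp only [factorGF]
  rw [← this, weightGF, PowerSeries.coeff_mk]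

end PolynomialModules

/-! ### Infinite products of formal power series. -/

section InfiniteProducts

open PowerSeries

theorem multipliable_of_X_pow_dvd {F : ℕ → PowerSeries ℤ}
    (h : ∀ j, (X : PowerSeries ℤ) ^ (j + 1) ∣ F j - 1) :
    Multipliable F := by
  have : F = fun j => 1 + (F j - 1) := by
    funext j
    ring
  rw [this]
  apply PowerSeries.WithPiTopology.multipliable_one_add_of_tendsto_order_atTop_nhds_top
  rw [ENat.tendsto_nhds_top_iff_natCast_lt]
  intro n
  filter_upwards [Filter.eventually_ge_atTop n] with j hj
  have h1 : ((j + 1 : ℕ) : ℕ∞) ≤ (F j - 1).order :=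
    nat_le_order _ _ fun i hi => X_pow_dvd_iff.1 (h j) i hi
  refine lt_of_lt_of_le ?_ h1
  exact_mod_cast Nat.lt_succ_of_le hj

theorem constantCoeff_of_hasProd {F : ℕ → PowerSeries ℤ} {a : PowerSeries ℤ} (h : HasProd F a)
    (hF : ∀ j, constantCoeff (F j) = 1) : constantCoeff a = 1 := by
  have h1 := h.map (constantCoeff (R := ℤ)) (PowerSeries.WithPiTopology.continuous_constantCoeff ℤ)
  have h2 : (constantCoeff (R := ℤ)) ∘ F = fun _ => 1 := funext hF
  rw [h2] at h1
  exact h1.unique hasProd_one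

theorem ne_zero_of_constantCoeff {a : PowerSeries ℤ} (h : constantCoeff a = 1) : a ≠ 0 := by
  rintro rfl
  simp at h

theorem X_pow_dvd_sub_one_mul {m : ℕ} {f g : PowerSeries ℤ} (hf : X ^ m ∣ f - 1)
    (hg : X ^ m ∣ g - 1) : X ^ m ∣ f * g - 1 := by
  have : f * g - 1 = (f - 1) * g + (g - 1) := by ring
  rw [this]
  exact dvd_add (hf.mul_right _) hg

theorem X_pow_dvd_one_sub {m e : ℕ} (c : PowerSeries ℤ) (h : m ≤ e) :
    X ^ m ∣ (1 - c * X ^ e) - 1 := by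
  rw [sub_right_comm, sub_self, zero_sub, dvd_neg]
  exact (pow_dvd_pow X h).mul_left c

theorem X_pow_dvd_one_add {m e : ℕ} (h : m ≤ e) :
    X ^ m ∣ ((1 : PowerSeries ℤ) + X ^ e) - 1 := by
  rw [add_sub_cancel_left]
  exact pow_dvd_pow X h

theorem X_pow_dvd_seriesDiv {m : ℕ} {f g : PowerSeries ℤ} (hm : m ≠ 0) (hf : X ^ m ∣ f - 1)
    (hg : X ^ m ∣ g - 1) : seriesDiv f g * g = f ∧ X ^ m ∣ seriesDiv f g - 1 := by
  have hc : constantCoeff g = 1 := by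
    have h1 := X_dvd_iff.1 ((dvd_pow_self X hm).trans hg)
    rwa [map_sub, map_one, sub_eq_zero] at h1
  have h := seriesDiv_mul_cancel f g hc
  refine ⟨h, ?_⟩
  have : seriesDiv f g - 1 = (f - 1) - seriesDiv f g * (g - 1) := by
    rw [mul_sub, h]
    ring
  rw [this]
  exact dvd_sub hf (hg.mul_left _)

theorem X_pow_dvd_factorGF (b : Prop) (j : ℕ) : X ^ (j + 1) ∣ factorGF b j - 1 := by
  rw [X_pow_dvd_iff]
  intro m hm
  rw [map_sub, coeff_factorGF_of_lt b hm, coeff_one, sub_self]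

theorem constantCoeff_factorGF (b : Prop) (j : ℕ) : constantCoeff (factorGF b j) = 1 := by
  rw [← coeff_zero_eq_constantCoeff_apply, coeff_factorGF_of_lt b (Nat.succ_pos j), if_pos rfl]

/-- The coefficient of degree `n` in the partial products is constant once `N ≥ n`. -/
theorem hasProd_factorGF (b : Prop) (c : ℕ → ℕ)
    (hc : ∀ n N : ℕ, n ≤ N → c n = Nat.card {x : ∀ j : Fin N, AllowedFactor b j //
      ∑ j : Fin N, ((j : ℕ) + 1) * (x j).1.natDegree = n}) :
    HasProd (factorGF b) (genFun c) := by
  have hm := (multipliable_of_X_pow_dvd (X_pow_dvd_factorGF b)).hasProd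
  have : ∏' j, factorGF b j = genFun c := by
    ext n
    have h1 := ((PowerSeries.WithPiTopology.continuous_coeff ℤ n).tendsto _).comp
      hm.tendsto_prod_nat
    refine tendsto_nhds_unique h1 (tendsto_const_nhds.congr' ?_)
    filter_upwards [Filter.eventually_ge_atTop n] with N hN
    rw [Function.comp_apply, coeff_prod_factorGF, ← hc n N hN, genFun, map_add, coeff_one, coeff_mk]
    split_ifs with h0
    -- The constant term of `genFun` is `1` by definition; it agrees with the count of the empty
    -- family.
    · subst h0
      rw [hc 0 0 le_rfl]
      simp
    · simp
  rwa [this] at hm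

/-- The product of the `1 - 2 X ^ (r (n + 1))`. -/
noncomputable def twoProd (r : ℕ) : PowerSeries ℤ := ∏' n : ℕ, (1 - 2 * X ^ (r * (n + 1)))

theorem hasProd_twoProd {r : ℕ} (hr : r ≠ 0) :
    HasProd (fun n : ℕ => (1 : PowerSeries ℤ) - 2 * X ^ (r * (n + 1))) (twoProd r) :=
  (multipliable_of_X_pow_dvd fun _ =>
    X_pow_dvd_one_sub 2 (Nat.le_mul_of_pos_left _ (Nat.pos_of_ne_zero hr))).hasProd

theorem twoProd_ne_zero {r : ℕ} (hr : r ≠ 0) : twoProd r ≠ 0 :=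
  ne_zero_of_constantCoeff (constantCoeff_of_hasProd (hasProd_twoProd hr) fun n => by simp [hr])

/-- The product of the `1 - 2 X ^ (2 m)` over odd `m`. -/
noncomputable def twoProdOdd : PowerSeries ℤ := ∏' k : ℕ, (1 - 2 * X ^ (2 * (2 * k + 1)))

theorem hasProd_twoProdOdd :
    HasProd (fun k : ℕ => (1 : PowerSeries ℤ) - 2 * X ^ (2 * (2 * k + 1))) twoProdOdd :=
  (multipliable_of_X_pow_dvd fun n => X_pow_dvd_one_sub 2 (by omega)).hasProd

theorem twoProd_two_eq : twoProd 2 = twoProdOdd * twoProd 4 := by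
  refine (hasProd_twoProd two_ne_zero).unique (HasProd.even_mul_odd hasProd_twoProdOdd ?_)
  convert hasProd_twoProd four_ne_zero using 4 with n
  ring

/-- Factors with odd `j + 1` contribute the numerators `1 - 2 X ^ (2 m)`, `m` odd, which form
`twoProd 2 / twoProd 4`. Everything is cross-multiplied, and nonzero limits are cancelled at the
end. -/
theorem hasProd_seriesDiv_mat (c : ℕ → ℕ) (hc : HasProd (factorGF False) (genFun c)) :
    HasProd (fun n : ℕ => seriesDiv (1 - 2 * (X : PowerSeries ℤ) ^ (2 * (n + 1)))
      ((1 - 2 * X ^ (n + 1)) * (1 - 2 * X ^ (4 * (n + 1))))) (genFun c) := by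
  have hdiv (n : ℕ) := X_pow_dvd_seriesDiv (Nat.succ_ne_zero n)
    (X_pow_dvd_one_sub (m := n + 1) (e := 2 * (n + 1)) 2 (by omega))
    (X_pow_dvd_sub_one_mul (X_pow_dvd_one_sub (m := n + 1) (e := n + 1) 2 le_rfl)
      (X_pow_dvd_one_sub (e := 4 * (n + 1)) 2 (by omega)))
  have hT := (multipliable_of_X_pow_dvd fun n => (hdiv n).2).hasProd
  convert hT using 1
  have h1 := hasProd_twoProd one_ne_zero
  simp only [one_mul] at h1
  have h5 := ((hT.mul (h1.mul (hasProd_twoProd four_ne_zero))).congr_fun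
    fun n => (hdiv n).1.symm).unique (hasProd_twoProd two_ne_zero)
  have h3 : HasProd (fun j : ℕ => factorGF False j * (1 - 2 * X ^ (j + 1))) (twoProdOdd * 1) := by
    refine HasProd.even_mul_odd ?_ ?_
    · convert hasProd_twoProdOdd using 2 with k
      rw [factorGF_of_even _ (even_two_mul k), squarefreeGF_false (Nat.succ_ne_zero _)]
    · convert (hasProd_one : HasProd (fun _ : ℕ => (1 : PowerSeries ℤ)) 1) using 2 with k
      rw [factorGF_of_odd _ (odd_two_mul_add_one k), monicGF_false (Nat.succ_ne_zero _)]
  have h4 := (hc.mul h1).unique h3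
  rw [twoProd_two_eq] at h5
  apply mul_right_cancel₀ (twoProd_ne_zero one_ne_zero)
  apply mul_right_cancel₀ (twoProd_ne_zero four_ne_zero)
  rw [h4, mul_one, ← h5, mul_assoc]

theorem hasProd_seriesDiv_GL (c : ℕ → ℕ) (hc : HasProd (factorGF True) (genFun c)) :
    HasProd (fun n : ℕ => seriesDiv
      ((1 - (X : PowerSeries ℤ) ^ (2 * (n + 1))) * (1 - 2 * X ^ (2 * (n + 1))))
      ((1 + X ^ (2 * (n + 1) - 1)) * (1 - 2 * X ^ (n + 1)) * (1 - 2 * X ^ (4 * (n + 1)))))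
      (genFun c) := by
  have hX (n e : ℕ) (h : n ≤ e) : X ^ n ∣ (1 - (X : PowerSeries ℤ) ^ e) - 1 := by
    simpa using X_pow_dvd_one_sub 1 h
  have hdiv (n : ℕ) := X_pow_dvd_seriesDiv (Nat.succ_ne_zero n)
    (X_pow_dvd_sub_one_mul (hX (n + 1) (2 * (n + 1)) (by omega))
      (X_pow_dvd_one_sub (m := n + 1) (e := 2 * (n + 1)) 2 (by omega)))
    (X_pow_dvd_sub_one_mul (X_pow_dvd_sub_one_mul
      (X_pow_dvd_one_add (m := n + 1) (e := 2 * (n + 1) - 1) (by omega))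
      (X_pow_dvd_one_sub (m := n + 1) (e := n + 1) 2 le_rfl))
      (X_pow_dvd_one_sub (e := 4 * (n + 1)) 2 (by omega)))
  have hT := (multipliable_of_X_pow_dvd fun n => (hdiv n).2).hasProd
  convert hT using 1
  have h1 := hasProd_twoProd one_ne_zero
  simp only [one_mul] at h1
  have hE := (multipliable_of_X_pow_dvd fun n => hX (n + 1) (2 * (n + 1)) (by omega)).hasProd
  have hP := (multipliable_of_X_pow_dvd fun n =>
    X_pow_dvd_one_add (m := n + 1) (e := 2 * (n + 1) - 1) (by omega)).hasProd
  set E := ∏' n : ℕ, (1 - (X : PowerSeries ℤ) ^ (2 * (n + 1)))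
  set P := ∏' n : ℕ, (1 + (X : PowerSeries ℤ) ^ (2 * (n + 1) - 1))
  have hP0 : P ≠ 0 := ne_zero_of_constantCoeff (constantCoeff_of_hasProd hP fun n => by
    rw [map_add, map_one, map_pow, constantCoeff_X, zero_pow (by omega), add_zero])
  have h2 := ((hT.mul ((hP.mul h1).mul (hasProd_twoProd four_ne_zero))).congr_fun
    fun n => (hdiv n).1.symm).unique (hE.mul (hasProd_twoProd two_ne_zero))
  have hsub (u : ℕ → ℕ) (hu : ∀ k, k ≤ u k) :
      Multipliable (fun k => factorGF True (u k)) ∧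
        Multipliable (fun k => (1 : PowerSeries ℤ) - 2 * X ^ (u k + 1)) :=
    ⟨multipliable_of_X_pow_dvd fun k => (pow_dvd_pow X (Nat.succ_le_succ (hu k))).trans
      (X_pow_dvd_factorGF True (u k)),
    multipliable_of_X_pow_dvd fun k => X_pow_dvd_one_sub 2 (Nat.succ_le_succ (hu k))⟩
  obtain ⟨⟨Ge, hGe⟩, ⟨De, hDe⟩⟩ := hsub (fun k => 2 * k) (fun k => by omega)
  obtain ⟨⟨Go, hGo⟩, ⟨Do, hDo⟩⟩ := hsub (fun k => 2 * k + 1) (fun k => by omega)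
  have hG : genFun c = Ge * Go := hc.unique (HasProd.even_mul_odd hGe hGo)
  have hD : twoProd 1 = De * Do := h1.unique (HasProd.even_mul_odd hDe hDo)
  -- Even indices carry squarefree factors, whose denominators supply `P`; odd indices carry monic
  -- ones, whose numerators supply `E`.
  have h3 : Ge * (De * P) = twoProdOdd := by
    refine ((hGe.mul (hDe.mul hP)).congr_fun fun k => ?_).unique hasProd_twoProdOdd
    have : 2 * (k + 1) - 1 = 2 * k + 1 := by omega
    rw [this]
    rw [factorGF_of_even True (even_two_mul k), squarefreeGF_true (Nat.succ_ne_zero _)]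
  have h4 : Go * Do = E := by
    refine ((hGo.mul hDo).congr_fun fun k => ?_).unique hE
    rw [factorGF_of_odd True (odd_two_mul_add_one k), monicGF_true (Nat.succ_ne_zero _)]
    rfl
  rw [twoProd_two_eq, ← h3, ← h4] at h2
  apply mul_right_cancel₀ (twoProd_ne_zero one_ne_zero)
  apply mul_right_cancel₀ (twoProd_ne_zero four_ne_zero)
  apply mul_right_cancel₀ hP0
  rw [hG]
  linear_combination (-1 : PowerSeries ℤ) * h2 + Ge * Go * twoProd 4 * P * hD

end InfiniteProducts

/-! ### Evaluation at `1 / 2` and the asymptotics of coefficients. -/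

section EvalHalf

open PowerSeries

/-- The integral power series `f` converges to `v` at `1 / 2`. -/
def EvalsTo (f : PowerSeries ℤ) (v : ℝ) : Prop :=
  HasSum (fun n => ((coeff n f : ℤ) : ℝ) * (1 / 2 : ℝ) ^ n) v

theorem EvalsTo.add {f g : PowerSeries ℤ} {u v : ℝ} (hf : EvalsTo f u) (hg : EvalsTo g v) :
    EvalsTo (f + g) (u + v) := by
  refine (HasSum.add hf hg).congr_fun fun n => ?_
  rw [map_add]
  push_cast
  ring

theorem EvalsTo.sub {f g : PowerSeries ℤ} {u v : ℝ} (hf : EvalsTo f u) (hg : EvalsTo g v) :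
    EvalsTo (f - g) (u - v) := by
  refine (HasSum.sub hf hg).congr_fun fun n => ?_
  rw [map_sub]
  push_cast
  ring

theorem EvalsTo.mul {f g : PowerSeries ℤ} {u v : ℝ} (hf : EvalsTo f u) (hg : EvalsTo g v) :
    EvalsTo (f * g) (u * v) := by
  have hf' : Summable fun n => ‖((coeff n f : ℤ) : ℝ) * (1 / 2 : ℝ) ^ n‖ := hf.summable.norm
  have hg' : Summable fun n => ‖((coeff n g : ℤ) : ℝ) * (1 / 2 : ℝ) ^ n‖ := hg.summable.norm
  have h1 := tsum_mul_tsum_eq_tsum_sum_antidiagonal_of_summable_norm hf' hg'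
  have h2 := (summable_norm_sum_mul_antidiagonal_of_summable_norm hf' hg').of_norm.hasSum
  rw [← h1, hf.tsum_eq, hg.tsum_eq] at h2
  refine h2.congr_fun fun n => ?_
  rw [coeff_mul]
  push_cast
  rw [Finset.sum_mul]
  refine Finset.sum_congr rfl fun p hp => ?_
  rw [← Finset.HasAntidiagonal.mem_antidiagonal.1 hp, pow_add]
  ring

theorem evalsTo_X_pow (e : ℕ) : EvalsTo (X ^ e) ((1 / 2 : ℝ) ^ e) := by
  unfold EvalsTo
  convert hasSum_single e ?_ using 1
  · simp [coeff_X_pow]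
  · intro n hn
    simp [coeff_X_pow, hn]

theorem evalsTo_one : EvalsTo 1 1 := by
  simpa using evalsTo_X_pow 0

theorem evalsTo_two : EvalsTo 2 2 := by
  simpa [one_add_one_eq_two] using evalsTo_one.add evalsTo_one

theorem EvalsTo.prod {G : ℕ → PowerSeries ℤ} {v : ℕ → ℝ} (h : ∀ j, EvalsTo (G j) (v j)) (N : ℕ) :
    EvalsTo (∏ j ∈ Finset.range N, G j) (∏ j ∈ Finset.range N, v j) := by
  induction N with
  | zero => simpa using evalsTo_one
  | succ N ih =>
    rw [Finset.prod_range_succ, Finset.prod_range_succ]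
    exact ih.mul (h N)

/-- Monotone convergence: nonnegative coefficients and constant terms `1` make the coefficients of
the partial products increase to those of `K`, so limit and summation may be exchanged. -/
theorem EvalsTo.of_hasProd {G : ℕ → PowerSeries ℤ} {K : PowerSeries ℤ} (hK : HasProd G K)
    (hG : ∀ j n, 0 ≤ coeff n (G j)) (hG1 : ∀ j, constantCoeff (G j) = 1) {v : ℕ → ℝ} {V : ℝ}
    (hv : ∀ j, EvalsTo (G j) (v j)) (hV : HasProd v V) : EvalsTo K V := by
  have hnn (N n : ℕ) : 0 ≤ coeff n (∏ j ∈ Finset.range N, G j) := by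
    induction N generalizing n with
    | zero =>
      rw [Finset.range_zero, Finset.prod_empty, coeff_one]
      split_ifs <;> simp
    | succ N ih =>
      rw [Finset.prod_range_succ, coeff_mul]
      exact Finset.sum_nonneg fun p _ => mul_nonneg (ih _) (hG _ _)
  have hmono (n : ℕ) : Monotone fun N => coeff n (∏ j ∈ Finset.range N, G j) := by
    refine monotone_nat_of_le_succ fun N => ?_
    rw [Finset.prod_range_succ, coeff_mul]
    have := Finset.single_le_sum (f := fun p : ℕ × ℕ =>
      coeff p.1 (∏ j ∈ Finset.range N, G j) * coeff p.2 (G N))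
      (fun p _ => mul_nonneg (hnn N p.1) (hG N p.2))
      (Finset.HasAntidiagonal.mem_antidiagonal.2 (add_zero n) :
        (n, 0) ∈ Finset.HasAntidiagonal.antidiagonal n)
    simpa [hG1] using this
  have hlim (n : ℕ) : Filter.Tendsto (fun N => coeff n (∏ j ∈ Finset.range N, G j)) Filter.atTop
      (nhds (coeff n K)) :=
    ((PowerSeries.WithPiTopology.continuous_coeff ℤ n).tendsto _).comp hK.tendsto_prod_nat
  have hle (N n : ℕ) : coeff n (∏ j ∈ Finset.range N, G j) ≤ coeff n K :=
    (hmono n).ge_of_tendsto (hlim n) N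
  have hprod (N : ℕ) : HasSum (fun n => ((coeff n (∏ j ∈ Finset.range N, G j) : ℤ) : ℝ) *
      (1 / 2 : ℝ) ^ n) (∏ j ∈ Finset.range N, v j) := EvalsTo.prod hv N
  have hnn' (N n : ℕ) : 0 ≤ ((coeff n (∏ j ∈ Finset.range N, G j) : ℤ) : ℝ) * (1 / 2 : ℝ) ^ n :=
    mul_nonneg (Int.cast_nonneg (hnn N n)) (by positivity)
  have hKnn (n : ℕ) : 0 ≤ ((coeff n K : ℤ) : ℝ) * (1 / 2 : ℝ) ^ n :=
    mul_nonneg (Int.cast_nonneg ((hnn 0 n).trans (hle 0 n))) (by positivity)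
  have hbound (s : Finset ℕ) : ∑ n ∈ s, ((coeff n K : ℤ) : ℝ) * (1 / 2 : ℝ) ^ n ≤ V := by
    refine le_of_tendsto_of_tendsto' (tendsto_finsetSum s fun n _ =>
      (((continuous_of_discreteTopology (f := fun z : ℤ => (z : ℝ))).tendsto _).comp
        (hlim n)).mul_const ((1 / 2 : ℝ) ^ n)) hV.tendsto_prod_nat fun N => ?_
    exact sum_le_hasSum s (fun n _ => hnn' N n) (hprod N)
  have hsum : Summable fun n => ((coeff n K : ℤ) : ℝ) * (1 / 2 : ℝ) ^ n :=
    summable_of_sum_le hKnn hbound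
  have hge : V ≤ ∑' n, ((coeff n K : ℤ) : ℝ) * (1 / 2 : ℝ) ^ n := by
    refine le_of_tendsto' hV.tendsto_prod_nat fun N => ?_
    refine hasSum_le (fun n => ?_) (hprod N) hsum.hasSum
    exact mul_le_mul_of_nonneg_right (Int.cast_le.2 (hle N n)) (by positivity)
  have := hsum.hasSum
  rwa [le_antisymm (hsum.tsum_le_of_sum_le hbound) hge] at this

theorem evalsTo_monicGF {k : ℕ} (hk : 2 ≤ k) :
    EvalsTo (monicGF False k) (1 - 2 * (1 / 2 : ℝ) ^ k)⁻¹ := by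
  have hlt : 2 * (1 / 2 : ℝ) ^ k < 1 := by
    have : (1 / 2 : ℝ) ^ k ≤ (1 / 2 : ℝ) ^ 2 :=
      pow_le_pow_of_le_one (by norm_num) (by norm_num) hk
    linarith
  have hinj : Function.Injective fun m : ℕ => k * m :=
    fun a b h => Nat.eq_of_mul_eq_mul_left (by omega) h
  have hcard := card_mul_fiber (fun f : MonicPoly False => f.1.natDegree) 2 k (by omega)
    card_monicPoly_natDegree_eq
  unfold EvalsTo
  rw [← hinj.hasSum_iff]
  · convert hasSum_geometric_of_lt_one (by positivity) hlt using 2 with m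
    change ((coeff (k * m) (monicGF False k) : ℤ) : ℝ) * (1 / 2) ^ (k * m) = _
    rw [monicGF, weightGF, coeff_mk, hcard, if_pos (dvd_mul_right k m),
      Nat.mul_div_cancel_left _ (by omega), mul_pow, ← pow_mul]
    push_cast
    rfl
  · intro n hn
    rw [monicGF, weightGF, coeff_mk, hcard, if_neg]
    · simp
    · rintro ⟨m, rfl⟩
      exact hn ⟨m, rfl⟩

/-- Index `0` is excluded because `1 - 2 z` vanishes at `1 / 2`. The invertible case follows by
comparing coefficients with the unrestricted one. -/
theorem exists_evalsTo_factorGF (b : Prop) {j : ℕ} (hj : j ≠ 0) :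
    ∃ v, EvalsTo (factorGF b j) v := by
  have hF : ∃ v, EvalsTo (factorGF False j) v := by
    have hm := evalsTo_monicGF (k := j + 1) (by omega)
    rcases Nat.even_or_odd j with h | h
    · rw [factorGF_of_even _ h]
      have h1 := squarefreeGF_false (k := j + 1) (by omega)
      have h2 := monicGF_false (k := j + 1) (by omega)
      have : squarefreeGF False (j + 1) =
          (1 - 2 * X ^ (2 * (j + 1))) * monicGF False (j + 1) := by
        linear_combination monicGF False (j + 1) * h1 - squarefreeGF False (j + 1) * h2
      rw [this]
      exact ⟨_, (evalsTo_one.sub (evalsTo_two.mul (evalsTo_X_pow _))).mul hm⟩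
    · rw [factorGF_of_odd _ h]
      exact ⟨_, hm⟩
  obtain ⟨v, hv⟩ := hF
  refine ⟨_, Summable.hasSum (Summable.of_nonneg_of_le (fun n => ?_) (fun n => ?_) hv.summable)⟩
  · exact mul_nonneg (Int.cast_nonneg (coeff_factorGF_nonneg b j n)) (by positivity)
  · exact mul_le_mul_of_nonneg_right (Int.cast_le.2 (coeff_factorGF_le b j n)) (by positivity)

/-- The value of the generating function `factorGF b (j + 1)` at `1 / 2`. -/
noncomputable def factorVal (b : Prop) (j : ℕ) : ℝ :=
  (exists_evalsTo_factorGF b (Nat.succ_ne_zero j)).choose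

theorem evalsTo_factorVal (b : Prop) (j : ℕ) : EvalsTo (factorGF b (j + 1)) (factorVal b j) :=
  (exists_evalsTo_factorGF b (Nat.succ_ne_zero j)).choose_spec

/-- Multiplication by `1 - 2 X` makes the series at `1 / 2` telescope: its partial sum through
degree `n` is the `n`-th term of `genFun c` at `1 / 2`. -/
theorem tendsto_div_two_pow {c : ℕ → ℕ} {a : ℝ} (h : EvalsTo (genFun c * (1 - 2 * X)) a) :
    Filter.Tendsto (fun n => (c n : ℝ) / 2 ^ n) Filter.atTop (nhds a) := by
  have h1 (n : ℕ) : ∑ i ∈ Finset.range (n + 1),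
      ((coeff i (genFun c * (1 - 2 * X)) : ℤ) : ℝ) * (1 / 2 : ℝ) ^ i =
        ((coeff n (genFun c) : ℤ) : ℝ) * (1 / 2 : ℝ) ^ n := by
    have h2 : genFun c * (1 - 2 * X) = genFun c - C (2 : ℤ) * (genFun c * X) := by
      rw [map_ofNat]
      ring
    rw [h2]
    induction n with
    | zero => simp
    | succ n ih =>
      rw [Finset.sum_range_succ, ih, map_sub, coeff_C_mul, coeff_succ_mul_X]
      push_cast
      ring
  have h3 := (HasSum.tendsto_sum_nat h).comp (Filter.tendsto_add_atTop_nat 1)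
  refine h3.congr' ?_
  filter_upwards [Filter.eventually_gt_atTop 0] with n hn
  rw [Function.comp_apply, h1, genFun, map_add, coeff_mk, coeff_one, if_neg hn.ne', if_neg hn.ne',
    zero_add, one_div, inv_pow]
  push_cast
  rw [div_eq_mul_inv]

theorem isEquivalent_of_evalsTo {c : ℕ → ℕ} {a : ℝ} (ha : a ≠ 0)
    (h : EvalsTo (genFun c * (1 - 2 * X)) a) :
    (fun n : ℕ => (c n : ℝ)) ~[Filter.atTop] (fun n : ℕ => a * 2 ^ n) := by
  rw [Asymptotics.isEquivalent_iff_tendsto_one]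
  · have := (tendsto_div_two_pow h).div_const a
    rw [div_self ha] at this
    refine this.congr fun n => ?_
    rw [Pi.div_apply, div_div, mul_comm a]
  · exact Filter.Eventually.of_forall fun n => mul_ne_zero ha (by positivity)

/-- The polar factor `j = 0` absorbs `1 - 2 X`; the remaining product converges at `1 / 2` factor by
factor. -/
theorem evalsTo_genFun_mul (b : Prop) {c : ℕ → ℕ} (hc : HasProd (factorGF b) (genFun c))
    {V s : ℝ} (hV : HasProd (factorVal b) V) (hs : EvalsTo (factorGF b 0 * (1 - 2 * X)) s) :
    EvalsTo (genFun c * (1 - 2 * X)) (s * V) := by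
  have hm : Multipliable fun j => factorGF b (j + 1) := multipliable_of_X_pow_dvd fun j =>
    (pow_dvd_pow X (Nat.le_succ _)).trans (X_pow_dvd_factorGF b (j + 1))
  have h1 := hc.unique hm.hasProd.zero_mul
  have h2 := EvalsTo.of_hasProd hm.hasProd (fun j => coeff_factorGF_nonneg b (j + 1))
    (fun j => constantCoeff_factorGF b (j + 1)) (evalsTo_factorVal b) hV
  rw [h1, mul_right_comm]
  exact hs.mul h2

theorem evalsTo_factorGF_false_zero : EvalsTo (factorGF False 0 * (1 - 2 * X)) (1 / 2) := by
  have h := squarefreeGF_false one_ne_zero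
  rw [factorGF_of_even _ Even.zero, zero_add, ← pow_one X, h]
  convert evalsTo_one.sub (evalsTo_two.mul (evalsTo_X_pow (2 * 1))) using 1
  norm_num

theorem evalsTo_factorGF_true_zero : EvalsTo (factorGF True 0 * (1 - 2 * X)) (1 / 3) := by
  have h := squarefreeGF_true one_ne_zero
  rw [factorGF_of_even _ Even.zero, zero_add]
  -- The alternating series is `1 / (1 + X)`, so the value sought is `(1 - 2 / 4) * (2 / 3) = 1 /
  -- 3`.
  have halt : EvalsTo (mk fun n => (-1 : ℤ) ^ n) (2 / 3) := by
    unfold EvalsTo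
    have := (hasSum_geometric_of_norm_lt_one (ξ := (-1 / 2 : ℝ)) (by norm_num)).congr_fun
      (g := fun n => ((coeff n (mk fun n => (-1 : ℤ) ^ n) : ℤ) : ℝ) * (1 / 2 : ℝ) ^ n) fun n => by
        rw [coeff_mk]
        push_cast
        rw [← mul_pow]
        norm_num
    have hval : (2 / 3 : ℝ) = (1 - -1 / 2)⁻¹ := by norm_num
    rw [hval]
    exact this
  have halt' : (mk fun n => (-1 : ℤ) ^ n) * (1 + X) = 1 := by
    ext n
    cases n with
    | zero => simp
    | succ n =>
      rw [mul_add, mul_one, map_add, coeff_succ_mul_X, coeff_mk, coeff_mk, coeff_one,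
        if_neg (Nat.succ_ne_zero n), pow_succ]
      ring
  have hS : squarefreeGF True 1 * (1 - 2 * X) =
      (1 - 2 * X ^ (2 * 1)) * mk fun n => (-1 : ℤ) ^ n := by
    rw [pow_one] at h
    linear_combination (mk fun n => (-1 : ℤ) ^ n) * h -
      squarefreeGF True 1 * (1 - 2 * X) * halt'
  rw [hS]
  convert (evalsTo_one.sub (evalsTo_two.mul (evalsTo_X_pow (2 * 1)))).mul halt using 1
  norm_num

end EvalHalf

/-! ### Positive real products and the values of the factors at `1 / 2`. -/

theorem exists_hasProd_pos {f : ℕ → ℝ} (hf : ∀ n, 0 < f n) (hs : Summable fun n => f n - 1) :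
    ∃ a : ℝ, 0 < a ∧ HasProd f a := by
  have h := Real.summable_log_one_add_of_summable hs
  simp only [add_sub_cancel] at h
  exact ⟨_, Real.exp_pos _, Real.hasProd_of_hasSum_log hf h.hasSum⟩

theorem summable_half_pow {e : ℕ → ℕ} (he : ∀ n, n ≤ e n) (c : ℝ) :
    Summable fun n => c * (1 / 2 : ℝ) ^ e n :=
  (Summable.of_nonneg_of_le (fun n => by positivity) (fun n => pow_le_pow_of_le_one (by norm_num)
    (by norm_num) (he n)) (summable_geometric_of_lt_one (by norm_num) (by norm_num))).mul_left c

theorem half_pow_le {m e : ℕ} (h : m ≤ e) : (1 / 2 : ℝ) ^ e ≤ (1 / 2 : ℝ) ^ m :=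
  pow_le_pow_of_le_one (by norm_num) (by norm_num) h

theorem one_sub_half_pow_pos {e : ℕ} (he : 1 ≤ e) : 0 < 1 - (1 / 2 : ℝ) ^ e := by
  have := half_pow_le he
  norm_num at this ⊢
  linarith

theorem one_sub_two_mul_half_pow_pos {e : ℕ} (he : 2 ≤ e) : 0 < 1 - 2 * (1 / 2 : ℝ) ^ e := by
  have := half_pow_le he
  norm_num at this ⊢
  linarith

theorem exists_hasProd_one_sub_two_mul {e : ℕ → ℕ} (he : ∀ n, n ≤ e n) (he2 : ∀ n, 2 ≤ e n) :
    ∃ a : ℝ, 0 < a ∧ HasProd (fun n => 1 - 2 * (1 / 2 : ℝ) ^ e n) a :=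
  exists_hasProd_pos (fun n => one_sub_two_mul_half_pow_pos (he2 n))
    ((summable_half_pow he (-2)).congr fun n => by ring)

theorem exists_hasProd_one_sub {e : ℕ → ℕ} (he : ∀ n, n ≤ e n) (he1 : ∀ n, 1 ≤ e n) :
    ∃ a : ℝ, 0 < a ∧ HasProd (fun n => 1 - (1 / 2 : ℝ) ^ e n) a :=
  exists_hasProd_pos (fun n => one_sub_half_pow_pos (he1 n))
    ((summable_half_pow he (-1)).congr fun n => by ring)

theorem exists_hasProd_one_add {e : ℕ → ℕ} (he : ∀ n, n ≤ e n) :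
    ∃ a : ℝ, 0 < a ∧ HasProd (fun n => 1 + (1 / 2 : ℝ) ^ e n) a :=
  exists_hasProd_pos (fun n => by positivity)
    ((summable_half_pow he 1).congr fun n => by ring)

section factorVal

open PowerSeries

theorem factorVal_false_even (k : ℕ) :
    factorVal False (2 * k) = (1 - 2 * (1 / 2 : ℝ) ^ (2 * k + 2))⁻¹ := by
  have h := evalsTo_factorVal False (2 * k)
  rw [factorGF_of_odd _ (odd_two_mul_add_one k)] at h
  exact HasSum.unique h (evalsTo_monicGF (by omega))

theorem factorVal_false_odd (k : ℕ) : factorVal False (2 * k + 1) =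
    (1 - 2 * (1 / 2 : ℝ) ^ (2 * (2 * k + 3))) / (1 - 2 * (1 / 2 : ℝ) ^ (2 * k + 3)) := by
  have h := (evalsTo_factorVal False (2 * k + 1)).mul
    (evalsTo_one.sub (evalsTo_two.mul (evalsTo_X_pow (2 * k + 3))))
  rw [factorGF_of_even _ (j := 2 * k + 1 + 1) ⟨k + 1, by ring⟩,
    squarefreeGF_false (k := 2 * k + 3) (by omega)] at h
  rw [eq_div_iff (one_sub_two_mul_half_pow_pos (by omega)).ne']
  exact HasSum.unique h (evalsTo_one.sub (evalsTo_two.mul (evalsTo_X_pow _)))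

theorem factorVal_true_even (k : ℕ) : factorVal True (2 * k) =
    (1 - (1 / 2 : ℝ) ^ (2 * (k + 1))) / (1 - 2 * (1 / 2 : ℝ) ^ (2 * k + 2)) := by
  have h := (evalsTo_factorVal True (2 * k)).mul
    (evalsTo_one.sub (evalsTo_two.mul (evalsTo_X_pow (2 * k + 2))))
  rw [factorGF_of_odd _ (odd_two_mul_add_one k), monicGF_true (k := 2 * k + 2) (by omega)] at h
  rw [eq_div_iff (one_sub_two_mul_half_pow_pos (by omega)).ne']
  exact HasSum.unique h (evalsTo_one.sub (evalsTo_X_pow _))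

theorem factorVal_true_odd (k : ℕ) : factorVal True (2 * k + 1) =
    (1 - 2 * (1 / 2 : ℝ) ^ (2 * (2 * k + 3))) /
      ((1 - 2 * (1 / 2 : ℝ) ^ (2 * k + 3)) * (1 + (1 / 2 : ℝ) ^ (2 * k + 3))) := by
  have h := (evalsTo_factorVal True (2 * k + 1)).mul
    ((evalsTo_one.sub (evalsTo_two.mul (evalsTo_X_pow (2 * k + 3)))).mul
      (evalsTo_one.add (evalsTo_X_pow (2 * k + 3))))
  rw [factorGF_of_even _ (j := 2 * k + 1 + 1) ⟨k + 1, by ring⟩,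
    squarefreeGF_true (k := 2 * k + 3) (by omega)] at h
  rw [eq_div_iff (mul_pos (one_sub_two_mul_half_pow_pos (by omega)) (by positivity)).ne']
  exact HasSum.unique h (evalsTo_one.sub (evalsTo_two.mul (evalsTo_X_pow _)))

end factorVal

theorem mainTheorem2 :
    -- identities of formal power series over `ℤ`; the index `n + 1` runs over `1, 2, 3, …`,
    -- and `HasProd` is convergence of the product in the coefficientwise topology
    HasProd
      (fun n : ℕ =>
        seriesDiv
          (1 - 2 * (PowerSeries.X : PowerSeries ℤ) ^ (2 * (n + 1)))
          ((1 - 2 * PowerSeries.X ^ (n + 1)) * (1 - 2 * PowerSeries.X ^ (4 * (n + 1)))))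
      (genFun squareClassesMat) ∧
    HasProd
      (fun n : ℕ =>
        seriesDiv
          ((1 - (PowerSeries.X : PowerSeries ℤ) ^ (2 * (n + 1))) *
            (1 - 2 * PowerSeries.X ^ (2 * (n + 1))))
          ((1 + PowerSeries.X ^ (2 * (n + 1) - 1)) * (1 - 2 * PowerSeries.X ^ (n + 1)) *
            (1 - 2 * PowerSeries.X ^ (4 * (n + 1)))))
      (genFun squareClassesGL) ∧
    ∃ α β : ℝ, 0 < α ∧ 0 < β ∧
      HasProd
        (fun n : ℕ =>
          (1 - 2 * (1 / 2 : ℝ) ^ (2 * (n + 1))) /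
            ((1 - (1 / 2 : ℝ) ^ (n + 1)) * (1 - 2 * (1 / 2 : ℝ) ^ (4 * (n + 1)))))
        α ∧
      HasProd
        (fun n : ℕ =>
          ((1 - (1 / 2 : ℝ) ^ (2 * (n + 1))) * (1 - 2 * (1 / 2 : ℝ) ^ (2 * (n + 1)))) /
            ((1 + (1 / 2 : ℝ) ^ (2 * (n + 1) - 1)) * (1 - (1 / 2 : ℝ) ^ (n + 1)) *
              (1 - 2 * (1 / 2 : ℝ) ^ (4 * (n + 1)))))
        β ∧
      (fun n : ℕ => (squareClassesMat n : ℝ)) ~[Filter.atTop] (fun n : ℕ => α * 2 ^ n) ∧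
      (fun n : ℕ => (squareClassesGL n : ℝ)) ~[Filter.atTop] (fun n : ℕ => β * 2 ^ n) := by
  have hmat := hasProd_factorGF False squareClassesMat fun n N h => squareClassesMat_eq h
  have hGL := hasProd_factorGF True squareClassesGL fun n N h => squareClassesGL_eq h
  refine ⟨hasProd_seriesDiv_mat _ hmat, hasProd_seriesDiv_GL _ hGL, ?_⟩
  -- Both constants are expressed through six elementary positive products, so that comparing them
  -- with the evaluated generating functions is plain field arithmetic.
  obtain ⟨de, hde0, hde⟩ := exists_hasProd_one_sub_two_mul (e := fun k => 2 * k + 2)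
    (fun k => by omega) (fun k => by omega)
  obtain ⟨dₒ, hdo0, hdo⟩ := exists_hasProd_one_sub_two_mul (e := fun k => 2 * k + 3)
    (fun k => by omega) (fun k => by omega)
  obtain ⟨o, ho0, ho⟩ := exists_hasProd_one_sub_two_mul (e := fun k => 2 * (2 * k + 3))
    (fun k => by omega) (fun k => by omega)
  obtain ⟨d4, hd40, hd4⟩ := exists_hasProd_one_sub_two_mul (e := fun k => 4 * (k + 1))
    (fun k => by omega) (fun k => by omega)
  obtain ⟨u, hu0, hu⟩ := exists_hasProd_one_sub (e := fun k => 2 * (k + 1))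
    (fun k => by omega) (fun k => by omega)
  obtain ⟨p, hp0, hp⟩ := exists_hasProd_one_add (e := fun k => 2 * k + 3) (fun k => by omega)
  -- Since `2 ^ (-(n + 1)) = 2 * 2 ^ (-(n + 2))`, this is the product of `1 - 2 z ^ k` over `k ≥ 2`
  -- at `z = 1 / 2`, split by the parity of `k`.
  have hd1 : HasProd (fun n : ℕ => 1 - (1 / 2 : ℝ) ^ (n + 1)) (de * dₒ) := by
    refine HasProd.even_mul_odd (hde.congr_fun fun k => ?_) (hdo.congr_fun fun k => ?_) <;> ring
  -- The constant `1 / 2` is the separated `k = 0` factor; likewise `3 / 2` in `hp'`.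
  have ho' : HasProd (fun k : ℕ => 1 - 2 * (1 / 2 : ℝ) ^ (2 * (2 * k + 1))) (1 / 2 * o) := by
    have := HasProd.zero_mul (f := fun k : ℕ => 1 - 2 * (1 / 2 : ℝ) ^ (2 * (2 * k + 1)))
      (ho.congr_fun fun k => by ring)
    convert this using 2
    norm_num
  have hp' : HasProd (fun k : ℕ => 1 + (1 / 2 : ℝ) ^ (2 * (k + 1) - 1)) (3 / 2 * p) := by
    have := HasProd.zero_mul (f := fun k : ℕ => 1 + (1 / 2 : ℝ) ^ (2 * (k + 1) - 1))
      (hp.congr_fun fun k => rfl)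
    convert this using 2
    norm_num
  have hd2 : HasProd (fun n : ℕ => 1 - 2 * (1 / 2 : ℝ) ^ (2 * (n + 1))) (1 / 2 * o * d4) :=
    HasProd.even_mul_odd ho' (hd4.congr_fun fun k => by ring)
  have hα := hd2.div₀ (hd1.mul hd4) (by positivity)
  have hβ := (hu.mul hd2).div₀ ((hp'.mul hd1).mul hd4) (by positivity)
  have hVmat : HasProd (factorVal False) (1 / de * (o / dₒ)) :=
    HasProd.even_mul_odd
      ((hasProd_one.div₀ hde hde0.ne').congr_fun fun k => by
        rw [factorVal_false_even, inv_eq_one_div])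
      ((ho.div₀ hdo hdo0.ne').congr_fun fun k => factorVal_false_odd k)
  have hVGL : HasProd (factorVal True) (u / de * (o / (dₒ * p))) :=
    HasProd.even_mul_odd
      ((hu.div₀ hde hde0.ne').congr_fun fun k => factorVal_true_even k)
      ((ho.div₀ (hdo.mul hp) (by positivity)).congr_fun fun k => factorVal_true_odd k)
  have hmat' := evalsTo_genFun_mul False hmat hVmat evalsTo_factorGF_false_zero
  have hGL' := evalsTo_genFun_mul True hGL hVGL evalsTo_factorGF_true_zero
  have hαeq : 1 / 2 * (1 / de * (o / dₒ)) = 1 / 2 * o * d4 / (de * dₒ * d4) := by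
    field_simp
  -- The polar factor's `1 / 3` is the quotient of the separated `1 / 2` and `3 / 2`.
  have hβeq : 1 / 3 * (u / de * (o / (dₒ * p))) =
      u * (1 / 2 * o * d4) / (3 / 2 * p * (de * dₒ) * d4) := by
    field_simp
  rw [hαeq] at hmat'
  rw [hβeq] at hGL'
  exact ⟨_, _, by positivity, by positivity, hα, hβ,
    isEquivalent_of_evalsTo (by positivity) hmat', isEquivalent_of_evalsTo (by positivity) hGL'⟩
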